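/- Let $p$ be a prime, $a \ge 1$ an integer, $q = p^a$, and let $k$ be an algebraically closed field of characteristic $p$. Let $S \subset \mathbf{P}^3$ be the surface over $k$ given by $$x_0x_1^q - x_1x_0^q + x_2x_3^q - x_3x_2^q = 0,$$ let $\ell$ be any line of $\mathbf{P}^3$ contained in $S$, let $L_0, L_1$ be linear forms with $\ell = \{L_0 = L_1 = 0\}$, and let $f : S\setminus\ell \to \mathbf{P}^1$, $x \mapsto (L_0(x):L_1(x))$, be the projection from $\ell$ (that is, the pencil of the planes through $\ell$). Varieties over $k$ are identified with their sets of $k$-points. A group scheme structure on $S \setminus \ell \to \mathbf{P}^1$ is a group law on each fiber $f^{-1}(t)$, $t\in\mathbf{P}^1$, such that the multiplication $(S\setminus\ell)\times_{\mathbf{P}^1}(S\setminus\ell) \to S\setminus\ell$, the inversion $S\setminus\ell\to S\setminus\ell$ and the unit section $\mathbf{P}^1 \to S\setminus\ell$ are morphisms. A section is a morphism $\sigma:\mathbf{P}^1\to S\setminus\ell$ with $f\circ\sigma = \mathrm{id}$. A fiber $f^{-1}(t)$ is called singular if it is reducible, and a line $m \ne \ell$ on $S$ is said to lie in the fiber over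 $t$ if $m\setminus \ell\subset f^{-1}(t)$. Then: 1. $S\setminus\ell\to\mathbf{P}^1$ admits a group scheme structure. 2. There are exactly $q^2+1$ singular fibers. For every group scheme structure on $S\setminus\ell\to\mathbf{P}^1$, each of the other fibers is isomorphic, as an algebraic group, to $\mathbf{G}_a$. 3. For every group scheme structure on $S\setminus\ell\to\mathbf{P}^1$, the group of its sections (with pointwise multiplication) is isomorphic to $(\mathbf{Z}/p\mathbf{Z})^{\oplus 4a}$. 4. The map $\sigma\mapsto\sigma(\mathbf{P}^1)$ is a bijection from the set of sections to the set of lines on $S$ that are different from $\ell$ and do not lie in a singular fiber, and there are exactly $q^4$ such lines. -/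

import Mathlib

open scoped LinearAlgebra.Projectivization

namespace LinePencil

/-! Quasi-projective varieties over an algebraically closed field `k` are treated as sets of
`k`-points with regular maps, `ℙ k (ι → k)` being the projective space with coordinates `ι`. -/

section Regular

variable {k : Type*} [Field k] {X Y ι κ μ : Type*}

/-- The vector of values of a tuple of polynomials at `v`. -/
noncomputable def values (G : κ → MvPolynomial ι k) (v : ι → k) : κ → k :=
  fun j => MvPolynomial.eval v (G j)

/-- Let `X` be a subset of a projective space (with inclusion `c`). A map `g` from `X` to a
projective space is regular if near every point of `X` it is given by homogeneous
polynomials of the same degree without common zero at that point. (Whether a homogeneous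
polynomial vanishes, and the point that a tuple of them defines, do not depend on the choice of
the representing vector.) -/
def IsRegular (c : X → ℙ k (ι → k)) (g : X → ℙ k (κ → k)) : Prop :=
  ∀ x : X, ∃ (d : ℕ) (G : κ → MvPolynomial ι k),
    (∀ j, (G j).IsHomogeneous d) ∧ values G (c x).rep ≠ 0 ∧
    ∀ (y : X) (h : values G (c y).rep ≠ 0), g y = Projectivization.mk k _ h

/-- `G` is bihomogeneous of bidegree `(d, e)` in the two groups of variables `ι` and `μ`. -/
def IsBihomogeneous (G : MvPolynomial (ι ⊕ μ) k) (d e : ℕ) : Prop :=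
  G.IsWeightedHomogeneous
    (Sum.elim (fun _ => ((1, 0) : ℕ × ℕ)) (fun _ => ((0, 1) : ℕ × ℕ))) (d, e)

/-- Let `X` be a subset of a product of two projective spaces (with inclusion `(c₁, c₂)`). A map
`g` from `X` to a projective space is regular if near every point of `X` it is given by
bihomogeneous polynomials of the same bidegree without common zero at that point. -/
def IsRegularOnProduct (c₁ : X → ℙ k (ι → k)) (c₂ : X → ℙ k (μ → k))
    (g : X → ℙ k (κ → k)) : Prop :=
  ∀ x : X, ∃ (d e : ℕ) (G : κ → MvPolynomial (ι ⊕ μ) k),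
    (∀ j, IsBihomogeneous (G j) d e) ∧ values G (Sum.elim (c₁ x).rep (c₂ x).rep) ≠ 0 ∧
    ∀ (y : X) (h : values G (Sum.elim (c₁ y).rep (c₂ y).rep) ≠ 0),
      g y = Projectivization.mk k _ h

/-- The point `(a : 1)` of the projective line; the affine line is the set of these points. -/
noncomputable def affinePoint (a : k) : ℙ k (Fin 2 → k) :=
  Projectivization.mk k ![a, 1] (fun h => one_ne_zero (congrFun h 1))

end Regular

section Composition

variable {k : Type*} [Field k] {X Y ι κ μ ν : Type*}

theorem rep_eq_smul {v : κ → k} {P : ℙ k (κ → k)} (h : v ≠ 0)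
    (hP : P = Projectivization.mk k v h) : ∃ c : k, c ≠ 0 ∧ v = c • P.rep := by
  have h2 : Projectivization.mk k v h = Projectivization.mk k P.rep P.rep_nonzero := by
    rw [← hP, Projectivization.mk_rep]
  obtain ⟨c, hc⟩ := (Projectivization.mk_eq_mk_iff' k _ _ h P.rep_nonzero).1 h2
  refine ⟨c, ?_, hc.symm⟩
  rintro rfl
  exact h (by rw [← hc, zero_smul])

theorem weight_eq (s : (ι ⊕ μ) →₀ ℕ) (m n : ℕ) {d e : ℕ}
    (hs : Finsupp.weight (Sum.elim (fun _ => ((1, 0) : ℕ × ℕ)) (fun _ => ((0, 1) : ℕ × ℕ))) s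
      = (d, e)) :
    ∑ i ∈ s.support, (Sum.elim (fun _ => m) (fun _ => n) i : ℕ) * s i = m * d + n * e := by
  rw [Finsupp.weight_apply, Finsupp.sum] at hs
  have h1 := congrArg Prod.fst hs
  have h2 := congrArg Prod.snd hs
  simp only [Prod.fst_sum, Prod.snd_sum] at h1 h2
  rw [← h1, ← h2, Finset.mul_sum, Finset.mul_sum, ← Finset.sum_add_distrib]
  refine Finset.sum_congr rfl fun i _ => ?_
  rcases i with i | i <;> simp

theorem IsBihomogeneous.eval_smul {G : MvPolynomial (ι ⊕ μ) k} {d e : ℕ}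
    (hG : IsBihomogeneous G d e) (a b : k) (v : ι → k) (w : μ → k) :
    MvPolynomial.eval (Sum.elim (a • v) (b • w)) G
      = a ^ d * b ^ e * MvPolynomial.eval (Sum.elim v w) G := by
  rw [MvPolynomial.eval_eq, MvPolynomial.eval_eq, Finset.mul_sum]
  refine Finset.sum_congr rfl fun s hs => ?_
  have hw := hG (MvPolynomial.mem_support_iff.1 hs)
  rw [Finsupp.weight_apply, Finsupp.sum] at hw
  have h1 := congrArg Prod.fst hw
  have h2 := congrArg Prod.snd hw
  simp only [Prod.fst_sum, Prod.snd_sum] at h1 h2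
  rw [← h1, ← h2, ← Finset.prod_pow_eq_pow_sum, ← Finset.prod_pow_eq_pow_sum,
    mul_left_comm, ← Finset.prod_mul_distrib, ← Finset.prod_mul_distrib]
  congr 1
  refine Finset.prod_congr rfl fun i _ => ?_
  rcases i with i | i <;> simp [mul_pow]

theorem IsBihomogeneous.bind {G : MvPolynomial (ι ⊕ μ) k} {d e m n : ℕ}
    (hG : IsBihomogeneous G d e) {A : ι → MvPolynomial ν k} {B : μ → MvPolynomial ν k}
    (hA : ∀ i, (A i).IsHomogeneous m) (hB : ∀ i, (B i).IsHomogeneous n) :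
    (MvPolynomial.bind₁ (Sum.elim A B) G).IsHomogeneous (m * d + n * e) := by
  rw [MvPolynomial.bind₁, MvPolynomial.aeval_def, MvPolynomial.eval₂_eq]
  refine MvPolynomial.IsHomogeneous.sum _ _ _ fun s hs => ?_
  have hw := weight_eq s m n (hG (MvPolynomial.mem_support_iff.1 hs))
  rw [← hw, ← zero_add (∑ i ∈ s.support, _)]
  refine (MvPolynomial.isHomogeneous_C ν _).mul ?_
  refine MvPolynomial.IsHomogeneous.prod _ _ _ fun i _ => ?_
  rcases i with i | i
  · exact (hA i).pow _
  · exact (hB i).pow _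

theorem IsHomogeneous.isBihomogeneous_rename {G : MvPolynomial ι k} {d : ℕ}
    (hG : G.IsHomogeneous d) :
    IsBihomogeneous (MvPolynomial.rename (Sum.inl : ι → ι ⊕ ι) G) d 0 := by
  intro s hs
  obtain ⟨u, rfl, hu⟩ := MvPolynomial.coeff_rename_ne_zero _ _ _ hs
  have h1 := hG hu
  rw [Finsupp.weight_apply, Finsupp.sum] at h1
  rw [Finsupp.weight_apply, Finsupp.sum_mapDomain_index (by simp) (by intros; simp [add_smul]),
    Finsupp.sum]
  ext <;> simp [Prod.fst_sum, Prod.snd_sum, ← h1]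

/-- A regular map may be viewed as a regular map on the diagonal. -/
theorem IsRegular.onProduct {c : X → ℙ k (ι → k)} {g : X → ℙ k (κ → k)}
    (hg : IsRegular c g) : IsRegularOnProduct c c g := by
  intro x
  obtain ⟨d, G, hG, hx, h⟩ := hg x
  have key : ∀ v w : ι → k,
      values (fun j => MvPolynomial.rename (Sum.inl : ι → ι ⊕ ι) (G j)) (Sum.elim v w)
        = values G v := by
    intro v w
    funext j
    simp [values, MvPolynomial.eval_rename]
  refine ⟨d, 0, _, fun j => IsHomogeneous.isBihomogeneous_rename (hG j), ?_, ?_⟩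
  · rw [key]; exact hx
  · intro y hy
    simp only [key] at hy ⊢
    exact h y hy

/-- Composition of regular maps. -/
theorem IsRegularOnProduct.comp {c₁ : X → ℙ k (ι → k)} {c₂ : X → ℙ k (μ → k)}
    {g : X → ℙ k (κ → k)} (hg : IsRegularOnProduct c₁ c₂ g) {c : Y → ℙ k (ν → k)} (s : Y → X)
    (h₁ : IsRegular c (fun y => c₁ (s y))) (h₂ : IsRegular c (fun y => c₂ (s y))) :
    IsRegular c (fun y => g (s y)) := by
  intro t
  obtain ⟨d, e, G, hG, hGt, hGe⟩ := hg (s t)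
  obtain ⟨m, A, hA, hAt, hAe⟩ := h₁ t
  obtain ⟨n, B, hB, hBt, hBe⟩ := h₂ t
  obtain ⟨i, hi⟩ := Function.ne_iff.1 hAt
  obtain ⟨j, hj⟩ := Function.ne_iff.1 hBt
  have ev : ∀ v : ν → k,
      values (fun l => A i * B j * MvPolynomial.bind₁ (Sum.elim A B) (G l)) v
        = (values A v i * values B v j) • values G (Sum.elim (values A v) (values B v)) := by
    intro v
    funext l
    have : (fun z => MvPolynomial.eval v (Sum.elim A B z))
        = Sum.elim (values A v) (values B v) := by
      funext z; rcases z with z | z <;> rfl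
    simp only [values, map_mul, Pi.smul_apply, smul_eq_mul]
    congr 1
    rw [MvPolynomial.bind₁, MvPolynomial.aeval_def, MvPolynomial.algebraMap_eq,
      MvPolynomial.eval₂_eq, MvPolynomial.eval_eq (Sum.elim _ _), map_sum]
    refine Finset.sum_congr rfl fun u _ => ?_
    simp only [map_mul, MvPolynomial.eval_C, map_prod, map_pow]
    congr 1
    refine Finset.prod_congr rfl fun z _ => ?_
    exact congrArg (· ^ u z) (congrFun this z)
  have sc : ∀ (a b : k) (v : ι → k) (w : μ → k),
      values G (Sum.elim (a • v) (b • w)) = (a ^ d * b ^ e) • values G (Sum.elim v w) := by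
    intro a b v w
    funext l
    exact (hG l).eval_smul a b v w
  refine ⟨m + n + (m * d + n * e), _, fun l => ((hA i).mul (hB j)).mul ((hG l).bind hA hB),
    ?_, ?_⟩
  · obtain ⟨a, ha, hav⟩ := rep_eq_smul hAt (hAe t hAt)
    obtain ⟨b, hb, hbv⟩ := rep_eq_smul hBt (hBe t hBt)
    rw [ev]
    refine smul_ne_zero (mul_ne_zero hi hj) ?_
    rw [hav, hbv, sc]
    exact smul_ne_zero (mul_ne_zero (pow_ne_zero _ ha) (pow_ne_zero _ hb)) hGt
  · intro y hy
    have hy' := hy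
    rw [ev] at hy'
    obtain ⟨h0, hGy⟩ := smul_ne_zero_iff.1 hy'
    have hAy : values A (c y).rep ≠ 0 := fun h => left_ne_zero_of_mul h0 (congrFun h i)
    have hBy : values B (c y).rep ≠ 0 := fun h => right_ne_zero_of_mul h0 (congrFun h j)
    obtain ⟨a, ha, hav⟩ := rep_eq_smul hAy (hAe y hAy)
    obtain ⟨b, hb, hbv⟩ := rep_eq_smul hBy (hBe y hBy)
    have hab : a ^ d * b ^ e ≠ 0 := mul_ne_zero (pow_ne_zero _ ha) (pow_ne_zero _ hb)
    have hval : values G (Sum.elim (values A (c y).rep) (values B (c y).rep))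
        = (a ^ d * b ^ e) • values G (Sum.elim (c₁ (s y)).rep (c₂ (s y)).rep) := by
      rw [hav, hbv, sc]
    rw [hval] at hGy
    obtain ⟨_, hGy'⟩ := smul_ne_zero_iff.1 hGy
    change g (s y) = _
    rw [hGe (s y) hGy', eq_comm, Projectivization.mk_eq_mk_iff']
    exact ⟨_, by rw [ev, hval, smul_smul]⟩

end Composition

section Pencil

variable {k : Type*} [Field k]

/-- The set of points of the surface `x₀ x₁^q - x₁ x₀^q + x₂ x₃^q - x₃ x₂^q = 0` in `ℙ³`. -/
def surface (k : Type*) [Field k] (q : ℕ) : Set (ℙ k (Fin 4 → k)) :=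
  {P | P.rep 0 * P.rep 1 ^ q - P.rep 1 * P.rep 0 ^ q
    + P.rep 2 * P.rep 3 ^ q - P.rep 3 * P.rep 2 ^ q = 0}

/-- The set of points of the linear subspace of `ℙ³` given by a linear subspace of `k⁴`. -/
def points (W : Submodule k (Fin 4 → k)) : Set (ℙ k (Fin 4 → k)) :=
  {P | P.submodule ≤ W}

/-- `W` is a line of `ℙ³` that lies on the surface. -/
def IsLineOnSurface (q : ℕ) (W : Submodule k (Fin 4 → k)) : Prop :=
  Module.finrank k W = 2 ∧ points W ⊆ surface k q

/-! In what follows `L : k⁴ → k²` is a linear map whose kernel is a line `ℓ` on the surface. Its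
two components are linear forms `L₀, L₁` that span the space of equations of `ℓ`, and the pencil of
planes through `ℓ` is `t₁ L₀ = t₀ L₁`, with `(t₀ : t₁)` in `ℙ¹`. -/

/-- The open part `S ∖ ℓ` of the surface. -/
def OpenPart (q : ℕ) (L : (Fin 4 → k) →ₗ[k] (Fin 2 → k)) : Type _ :=
  {P : ℙ k (Fin 4 → k) // P ∈ surface k q ∧ P ∉ points (LinearMap.ker L)}

/-- The projection `S ∖ ℓ → ℙ¹` from the line `ℓ`, `x ↦ (L₀(x) : L₁(x))`. -/
noncomputable def pencil (q : ℕ) (L : (Fin 4 → k) →ₗ[k] (Fin 2 → k)) (P : OpenPart q L) :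
    ℙ k (Fin 2 → k) :=
  Projectivization.mk k (L P.1.rep) fun h => P.2.2 <| by
    change P.1.submodule ≤ _
    rw [Projectivization.submodule_eq, Submodule.span_singleton_le_iff_mem]
    exact h

/-- The fibre of `S ∖ ℓ → ℙ¹` over `t`. -/
def Fibre (q : ℕ) (L : (Fin 4 → k) →ₗ[k] (Fin 2 → k)) (t : ℙ k (Fin 2 → k)) : Type _ :=
  {P : OpenPart q L // pencil q L P = t}

/-- A point of a fibre, as a point of `ℙ³`. -/
def Fibre.pt {q : ℕ} {L : (Fin 4 → k) →ₗ[k] (Fin 2 → k)} {t : ℙ k (Fin 2 → k)}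
    (x : Fibre q L t) : ℙ k (Fin 4 → k) := x.1.1

/-- The structure of a group scheme over `ℙ¹` on `S ∖ ℓ → ℙ¹`: a group law on every fibre, such
that the multiplication `(S ∖ ℓ) ×_{ℙ¹} (S ∖ ℓ) → S ∖ ℓ`, the inversion `S ∖ ℓ → S ∖ ℓ` and the
unit section `ℙ¹ → S ∖ ℓ` are regular. -/
class PencilGroup (q : ℕ) (L : (Fin 4 → k) →ₗ[k] (Fin 2 → k)) where
  grp : ∀ t, Group (Fibre q L t)
  regular_mul : IsRegularOnProduct (X := Σ t, Fibre q L t × Fibre q L t)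
    (fun z => z.2.1.pt) (fun z => z.2.2.pt) (fun z => (z.2.1 * z.2.2).pt)
  regular_inv : IsRegular (X := Σ t, Fibre q L t) (fun z => z.2.pt) (fun z => (z.2⁻¹).pt)
  regular_one : IsRegular (fun t => t) (fun t => (1 : Fibre q L t).pt)

attribute [reducible, instance] PencilGroup.grp

/-- A section of `S ∖ ℓ → ℙ¹` is a regular map `ℙ¹ → S ∖ ℓ` that takes every `t` to a point of the
fibre over `t`. -/
def IsSection (q : ℕ) (L : (Fin 4 → k) →ₗ[k] (Fin 2 → k)) (σ : ∀ t, Fibre q L t) : Prop :=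
  IsRegular (fun t => t) (fun t => (σ t).pt)

/-- The group of sections of a group scheme structure on `S ∖ ℓ → ℙ¹`, with the pointwise
multiplication. -/
def sections (q : ℕ) (L : (Fin 4 → k) →ₗ[k] (Fin 2 → k)) [PencilGroup q L] :
    Subgroup (∀ t, Fibre q L t) where
  carrier := {σ | IsSection q L σ}
  one_mem' := PencilGroup.regular_one
  mul_mem' {σ τ} hσ hτ :=
    (PencilGroup.regular_mul (q := q) (L := L)).comp (fun t => ⟨t, σ t, τ t⟩) hσ hτ
  inv_mem' {σ} hσ :=
    (PencilGroup.regular_inv (q := q) (L := L)).onProduct.comp (fun t => ⟨t, σ t⟩) hσ hσ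

/-- The fibre over `t` is singular in the sense of the pencil, that is, degenerate: it is
reducible, being covered by two Zariski closed sets neither of which contains it. -/
def IsSingularFibre (q : ℕ) (L : (Fin 4 → k) →ₗ[k] (Fin 2 → k)) (t : ℙ k (Fin 2 → k)) : Prop :=
  ∃ (d₁ d₂ : ℕ) (G₁ G₂ : MvPolynomial (Fin 4) k), G₁.IsHomogeneous d₁ ∧ G₂.IsHomogeneous d₂ ∧
    (∀ x : Fibre q L t, MvPolynomial.eval x.pt.rep G₁ = 0 ∨ MvPolynomial.eval x.pt.rep G₂ = 0) ∧
    (∃ x : Fibre q L t, MvPolynomial.eval x.pt.rep G₁ ≠ 0) ∧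
    (∃ x : Fibre q L t, MvPolynomial.eval x.pt.rep G₂ ≠ 0)

/-- All points of the line `W` outside `ℓ` lie over `t`; for a line `W ≠ ℓ` on the surface this
says that `W` is contained in the (closed) fibre over `t`. -/
def LiesOver (q : ℕ) (L : (Fin 4 → k) →ₗ[k] (Fin 2 → k)) (W : Submodule k (Fin 4 → k))
    (t : ℙ k (Fin 2 → k)) : Prop :=
  ∀ P : OpenPart q L, P.1 ∈ points W → pencil q L P = t

/-- The lines on the surface that are different from `ℓ` and not contained in a singular fibre. -/
def transversalLines (q : ℕ) (L : (Fin 4 → k) →ₗ[k] (Fin 2 → k)) :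
    Set (Submodule k (Fin 4 → k)) :=
  {W | IsLineOnSurface q W ∧ W ≠ LinearMap.ker L ∧
    ∀ t, IsSingularFibre q L t → ¬ LiesOver q L W t}

/-- The fibre over `t` is isomorphic, as an algebraic group, to the additive group `𝔾ₐ`. -/
def IsAdditiveFibre (q : ℕ) (L : (Fin 4 → k) →ₗ[k] (Fin 2 → k)) [PencilGroup q L]
    (t : ℙ k (Fin 2 → k)) : Prop :=
  ∃ e : Multiplicative k ≃* Fibre q L t,
    IsRegular (X := k) affinePoint (fun a => (e (Multiplicative.ofAdd a)).pt) ∧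
    IsRegular (X := Fibre q L t) Fibre.pt (fun x => affinePoint (Multiplicative.toAdd (e.symm x)))

end Pencil

end LinePencil

/-!
Write `q = p ^ a` and `β(v, w) = v₀ w₁^q - v₁ w₀^q + v₂ w₃^q - v₃ w₂^q`, so that the surface is
`β(v, v) = 0`. A line on the surface is a plane `W` in `k⁴` that is totally isotropic for `β`, and
the nondegeneracy of `β` makes `W` stable under the `q²`-Frobenius. Hence `W` has a basis with
coordinates in the field with `q²` elements, and there are coordinates `(x, y)` on `k⁴ = k² × k²` in
which `W` is `y = 0` and the surface is `x · y^q = y · x^q` (`exists_normalForm`).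

Fixing `y = τ`, where `τ` represents the point `t` of the projective line, identifies the fibre over
`t` with the additive group `{x ∈ k² : x · τ^q = τ · x^q}`. Addition of `x` is given by bilinear
forms in the homogeneous coordinates, which gives the group scheme structure (`pencilGroup`). With
`c = τ^{1/q}` the equation reads `τ^q · x = (c · x)^q`. If `τ^q` and `c` are independent, the fibre
is the graph of a function, an affine line with the additive parameter `c · x`
(`exists_affine_coordinate`); if they are proportional, it is a union of `q` parallel lines. The
latter happens when `τ` is proportional to its `q²`-Frobenius transform (`isSingularFibre_iff`), that
is, for the `q² + 1` points of the projective line over the field with `q²` elements.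

For an arbitrary group scheme structure, the translations of a nonsingular fibre are automorphisms of
the affine line, so they are affine, and the group law is `x + x' - x(1)`
(`coord_mul_of_polynomial_translations`, `coord_mul_of_not_isDegenerate`).

A regular function on the affine line is a polynomial
(`exists_polynomial_of_locally_rational`); comparing the two affine charts of the projective line, a
section is given by `x = M y` for a matrix `M` (`exists_matrix_of_isSection`). The image lies on the
surface exactly when the transpose of `M` is its `q`-Frobenius transform, so `M` is one of the `q⁴`
Hermitian matrices over the field with `q²` elements (`hermitian`, `card_hermitian`). Since there are
enough nonsingular fibres to determine a section, subtracting the unit section identifies the group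
of sections with the additive group of these matrices (`nonempty_sections_mulEquiv`). Conversely, a
line on the surface other than `ker L` either meets `ker L`, and then isotropy forces it to lie in a
singular fibre, or it is the graph `x = M y` of a Hermitian matrix (`exists_eq_lineOf`).
-/

namespace LinePencil

/-! ### Polynomial functions on the affine line -/

section Polynomials

open Polynomial

variable {k : Type*} [Field k]

/-- A function on the affine line that is locally a quotient of polynomials is a polynomial. -/
theorem exists_polynomial_of_locally_rational [IsAlgClosed k] (f : k → k)
    (h : ∀ s₀, ∃ P Q : k[X], Q.eval s₀ ≠ 0 ∧ ∀ s, Q.eval s ≠ 0 → f s * Q.eval s = P.eval s) :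
    ∃ P : k[X], ∀ s, f s = P.eval s := by
  have key : ∀ (n : ℕ) (P Q : k[X]), Q ≠ 0 → Q.natDegree ≤ n →
      (∀ s, Q.eval s ≠ 0 → f s * Q.eval s = P.eval s) → ∃ P : k[X], ∀ s, f s = P.eval s := by
    intro n
    induction n with
    | zero =>
      intro P Q hQ hn hPQ
      obtain ⟨c, rfl⟩ := natDegree_eq_zero.1 (Nat.le_zero.1 hn)
      have hc : c ≠ 0 := fun h => hQ (by rw [h, C_0])
      refine ⟨C c⁻¹ * P, fun s => ?_⟩
      have := hPQ s (by simpa using hc)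
      simp only [eval_C, eval_mul] at this ⊢
      rw [← this]; field_simp
    | succ n ih =>
      intro P Q hQ hn hPQ
      by_cases hd : Q.natDegree = 0
      · exact ih P Q hQ (by omega) hPQ
      obtain ⟨s₀, hs₀⟩ := IsAlgClosed.exists_root Q
        (fun h => hd (natDegree_eq_zero_iff_degree_le_zero.2 h.le))
      obtain ⟨P₁, Q₁, hQ₁, hPQ₁⟩ := h s₀
      have hQ₁0 : Q₁ ≠ 0 := fun h => hQ₁ (by simp [h])
      -- two local expressions of `f` agree wherever both denominators are nonzero
      have hcross : P * Q₁ = P₁ * Q := by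
        have : (Q * Q₁) * (P * Q₁ - P₁ * Q) = 0 := by
          refine Polynomial.funext fun s => ?_
          simp only [eval_mul, eval_sub, eval_zero, mul_eq_zero]
          by_cases h1 : Q.eval s = 0
          · simp [h1]
          by_cases h2 : Q₁.eval s = 0
          · simp [h2]
          right
          rw [← hPQ s h1, ← hPQ₁ s h2]; ring
        rcases mul_eq_zero.1 this with h' | h'
        · exact absurd h' (mul_ne_zero hQ hQ₁0)
        · exact sub_eq_zero.1 h'
      have hP0 : P.IsRoot s₀ := by
        have := congrArg (eval s₀) hcross
        simp only [eval_mul, hs₀.eq_zero, mul_zero, mul_eq_zero] at this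
        exact this.resolve_right hQ₁
      obtain ⟨P', rfl⟩ := dvd_iff_isRoot.2 hP0
      obtain ⟨Q', rfl⟩ := dvd_iff_isRoot.2 hs₀
      have hQ' : Q' ≠ 0 := right_ne_zero_of_mul hQ
      have hX : (X - C s₀ : k[X]) ≠ 0 := X_sub_C_ne_zero s₀
      have hcross' : P' * Q₁ = P₁ * Q' := by
        apply mul_left_cancel₀ hX
        rw [← mul_assoc, hcross]; ring
      refine ih P' Q' hQ' ?_ fun s hs => ?_
      · rw [natDegree_mul hX hQ', natDegree_X_sub_C] at hn; omega
      · by_cases hss : s = s₀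
        · subst hss
          have h1 := congrArg (eval s) hcross'
          have h2 := hPQ₁ s hQ₁
          simp only [eval_mul] at h1
          rw [← h2] at h1
          apply mul_right_cancel₀ hQ₁
          rw [h1]; ring
        · have hss' : s - s₀ ≠ 0 := sub_ne_zero.2 hss
          have := hPQ s (by simpa [hss'] using hs)
          simp only [eval_mul, eval_sub, eval_X, eval_C] at this
          apply mul_left_cancel₀ hss'
          rw [← this]; ring
  obtain ⟨P, Q, hQ, hPQ⟩ := h 0
  exact key _ P Q (fun h => hQ (by simp [h])) le_rfl hPQ

theorem natDegree_le_one_of_eval_eq [Infinite k] {P P' : k[X]}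
    (h : ∀ s, s ≠ 0 → P.eval s = s * P'.eval s⁻¹) : P.natDegree ≤ 1 := by
  have hE : X ^ P'.natDegree * P = X * P'.reverse := by
    have : X * (X ^ P'.natDegree * P - X * P'.reverse) = 0 := by
      refine Polynomial.funext fun s => ?_
      simp only [eval_mul, eval_X, eval_sub, eval_pow, eval_zero, mul_eq_zero]
      by_cases hs : s = 0
      · exact Or.inl hs
      right
      let _ := invertibleOfNonzero (inv_ne_zero hs)
      have h1 := eval₂_reverse_mul_pow (RingHom.id k) s⁻¹ P'
      rw [invOf_eq_inv, inv_inv, eval₂_id, eval₂_id] at h1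
      rw [h s hs, ← h1, inv_pow]
      field_simp
      simp
    exact sub_eq_zero.1 ((mul_eq_zero.1 this).resolve_left X_ne_zero)
  by_cases hP : P = 0
  · simp [hP]
  have h1 := congrArg natDegree hE
  rw [natDegree_mul (pow_ne_zero _ X_ne_zero) hP, natDegree_X_pow] at h1
  have h2 : (X * P'.reverse).natDegree ≤ 1 + P'.natDegree :=
    natDegree_mul_le.trans (add_le_add natDegree_X_le (reverse_natDegree_le P'))
  omega

/-- The two affine expressions of a section of `𝒪(1)` on the projective line are linear. -/
theorem exists_linear_of_eval_eq [Infinite k] {P P' : k[X]}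
    (h : ∀ s, s ≠ 0 → P.eval s = s * P'.eval s⁻¹) :
    ∃ a b : k, (∀ s, P.eval s = a * s + b) ∧ ∀ s, P'.eval s = a + b * s := by
  have h' : ∀ s, s ≠ 0 → P'.eval s = s * P.eval s⁻¹ := by
    intro s hs
    rw [h _ (inv_ne_zero hs), inv_inv, mul_inv_cancel_left₀ hs]
  obtain ⟨a, b, rfl⟩ := exists_eq_X_add_C_of_natDegree_le_one (natDegree_le_one_of_eval_eq h)
  refine ⟨a, b, fun s => by simp, ?_⟩
  have : X * (P' - (C a + C b * X)) = 0 := by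
    refine Polynomial.funext fun s => ?_
    by_cases hs : s = 0
    · simp [hs]
    simp only [eval_mul, eval_X, eval_sub, eval_add, eval_C, eval_zero, mul_eq_zero, hs, false_or]
    rw [h' s hs]
    simp only [eval_mul, eval_X, eval_add, eval_C]
    field_simp
    ring
  intro s
  rw [sub_eq_zero.1 ((mul_eq_zero.1 this).resolve_left X_ne_zero)]
  simp

theorem exists_affine_of_polynomial_inverse [Infinite k] {P Q : k[X]}
    (h : ∀ s, P.eval (Q.eval s) = s) : ∃ a b : k, a ≠ 0 ∧ ∀ s, Q.eval s = a * s + b := by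
  have hc : P.comp Q = X := Polynomial.funext fun s => by simp [eval_comp, h]
  have hd := congrArg natDegree hc
  rw [natDegree_comp, natDegree_X] at hd
  have hQ : Q.natDegree = 1 := (mul_eq_one.1 hd).2
  obtain ⟨a, b, rfl⟩ := exists_eq_X_add_C_of_natDegree_le_one hQ.le
  refine ⟨a, b, ?_, fun s => by simp⟩
  rintro rfl
  simp at hQ

/-- A group law on the affine line all of whose translations are polynomial is the addition, up to
the choice of the neutral element: the translations are polynomial bijections with polynomial
inverse, so they are affine, and since the leading coefficient of the translation by `g` is an
affine function of `g` without zeros, it is constant. -/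
theorem coord_mul_of_polynomial_translations [Infinite k] {G : Type*} [Group G] (v : G ≃ k)
    (hl : ∀ g, ∃ P : k[X], ∀ h, v (g * h) = P.eval (v h))
    (hr : ∀ h, ∃ P : k[X], ∀ g, v (g * h) = P.eval (v g)) (g h : G) :
    v (g * h) = v g + v h - v 1 := by
  have hl' : ∀ g, ∃ a b : k, a ≠ 0 ∧ ∀ h, v (g * h) = a * v h + b := by
    intro g
    obtain ⟨P, hP⟩ := hl g⁻¹
    obtain ⟨Q, hQ⟩ := hl g
    obtain ⟨a, b, ha, hab⟩ := exists_affine_of_polynomial_inverse (P := P) (Q := Q) fun s => by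
      obtain ⟨h, rfl⟩ := v.surjective s
      rw [← hQ, ← hP, inv_mul_cancel_left]
    exact ⟨a, b, ha, fun h => by rw [hQ, hab]⟩
  have hr' : ∀ h, ∃ a b : k, ∀ g, v (g * h) = a * v g + b := by
    intro h
    obtain ⟨P, hP⟩ := hr h⁻¹
    obtain ⟨Q, hQ⟩ := hr h
    obtain ⟨a, b, -, hab⟩ := exists_affine_of_polynomial_inverse (P := P) (Q := Q) fun s => by
      obtain ⟨g, rfl⟩ := v.surjective s
      rw [← hQ, ← hP, mul_inv_cancel_right]
    exact ⟨a, b, fun g => by rw [hQ, hab]⟩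
  choose α β hα hαβ using hl'
  obtain ⟨a₀, b₀, h₀⟩ := hr' (v.symm 0)
  obtain ⟨a₁, b₁, h₁⟩ := hr' (v.symm 1)
  have e₀ : ∀ g, β g = a₀ * v g + b₀ := fun g => by
    rw [← h₀, hαβ, v.apply_symm_apply]; ring
  have e₁ : ∀ g, α g = (a₁ - a₀) * v g + (b₁ - b₀) := fun g => by
    have h2 := h₁ g
    rw [hαβ, v.apply_symm_apply, e₀] at h2
    linear_combination h2
  have hs : a₁ - a₀ = 0 := by
    by_contra hs
    refine hα (v.symm (-(b₁ - b₀) / (a₁ - a₀))) ?_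
    rw [e₁, v.apply_symm_apply]
    field_simp
    ring
  have hα1 : ∀ g, α g = 1 := by
    intro g
    have h2 : α g = α 1 := by rw [e₁, e₁, hs]; ring
    have h3 := hαβ 1 (v.symm 0)
    have h4 := hαβ 1 (v.symm 1)
    rw [one_mul, v.apply_symm_apply] at h3 h4
    rw [h2]
    linear_combination h3 - h4
  have h5 := hαβ g 1
  rw [mul_one, hα1] at h5
  rw [hαβ, hα1]
  linear_combination -h5

theorem exists_sub_pow_eq [IsAlgClosed k] {n : ℕ} (hn : 1 < n) (c : k) : ∃ e : k, e - e ^ n = c := by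
  have hd : (X - X ^ n - C c : k[X]).natDegree = n := by
    rw [natDegree_sub_C, natDegree_sub_eq_right_of_natDegree_lt (by simpa using hn),
      natDegree_X_pow]
  obtain ⟨e, he⟩ := IsAlgClosed.exists_root (X - X ^ n - C c : k[X])
    (fun h => by rw [natDegree_eq_zero_iff_degree_le_zero.2 h.le] at hd; omega)
  refine ⟨e, ?_⟩
  simpa [sub_eq_zero] using he

theorem exists_pow_ne_self [Infinite k] {n : ℕ} (hn : 1 < n) : ∃ s : k, s ^ n ≠ s := by
  by_contra! h
  have : (X ^ n : k[X]) = X := Polynomial.funext fun s => by simpa using h s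
  have h2 := congrArg natDegree this
  rw [natDegree_X_pow, natDegree_X] at h2
  omega

theorem eq_zero_of_add_pow_eq_zero [Infinite k] {n : ℕ} (hn : 1 < n) {A B : k}
    (h : ∀ s : k, s * A + s ^ n * B = 0) : A = 0 ∧ B = 0 := by
  obtain ⟨s, hs⟩ := exists_pow_ne_self (k := k) hn
  have h1 := h 1
  have h2 := h s
  have hA : A = 0 := by
    have : (s - s ^ n) * A = 0 := by linear_combination h2 - s ^ n * h1
    exact (mul_eq_zero.1 this).resolve_left (sub_ne_zero.2 (Ne.symm hs))
  subst hA
  simpa using h1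

theorem ncard_pow_eq_self [IsAlgClosed k] (p : ℕ) [Fact p.Prime] [CharP k p] {n : ℕ}
    (hn : n ≠ 0) : {s : k | s ^ p ^ n = s}.ncard = p ^ n := by
  classical
  have hp : 1 < p ^ n := Nat.one_lt_pow hn (Fact.out : p.Prime).one_lt
  have hd : (X ^ p ^ n - X : k[X]).natDegree = p ^ n := by
    rw [natDegree_sub_eq_left_of_natDegree_lt (by simpa using hp), natDegree_X_pow]
  have hset : {s : k | s ^ p ^ n = s} = (X ^ p ^ n - X : k[X]).rootSet k := by
    ext s
    rw [mem_rootSet_of_ne (fun h => by 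
      rw [h, natDegree_zero] at hd
      rw [← hd] at hp
      exact absurd hp (by norm_num))]
    simp [sub_eq_zero]
  rw [hset, ← Nat.card_coe_set_eq, Nat.card_eq_fintype_card,
    card_rootSet_eq_natDegree (galois_poly_separable p _ (dvd_pow_self p hn))
      (IsAlgClosed.splits _), hd]

end Polynomials

/-! ### Regular maps -/

section RegularMaps

variable {k : Type*} [Field k] {X ι κ μ : Type*}

theorem mk_eq_mk_of_eq_smul {v w : κ → k} {a : k} (hv : v ≠ 0) (hw : w ≠ 0) (h : v = a • w) :
    Projectivization.mk k v hv = Projectivization.mk k w hw :=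
  (Projectivization.mk_eq_mk_iff' k v w hv hw).2 ⟨a, h.symm⟩

theorem exists_eq_smul_of_mk_eq_mk {v w : κ → k} {hv : v ≠ 0} {hw : w ≠ 0}
    (h : Projectivization.mk k v hv = Projectivization.mk k w hw) : ∃ a : k, a ≠ 0 ∧ v = a • w := by
  obtain ⟨a, ha⟩ := (Projectivization.mk_eq_mk_iff' k v w hv hw).1 h
  refine ⟨a, ?_, ha.symm⟩
  rintro rfl
  exact hv (by rw [← ha, zero_smul])

theorem exists_rep_mk_eq_smul {v : κ → k} (hv : v ≠ 0) :
    ∃ a : k, a ≠ 0 ∧ (Projectivization.mk k v hv).rep = a • v :=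
  exists_eq_smul_of_mk_eq_mk (hv := Projectivization.rep_nonzero _) (hw := hv)
    (Projectivization.mk_rep _)

theorem values_smul {G : κ → MvPolynomial ι k} {d : ℕ} (hG : ∀ j, (G j).IsHomogeneous d) (c : k)
    (v : ι → k) : values G (c • v) = c ^ d • values G v := by
  funext j
  have h := (IsHomogeneous.isBihomogeneous_rename (hG j)).eval_smul c 1 v v
  rw [MvPolynomial.eval_rename, MvPolynomial.eval_rename] at h
  simpa [values] using h

theorem isRegular_const (c : X → ℙ k (ι → k)) (P : ℙ k (κ → k)) : IsRegular c (fun _ => P) := by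
  have h : ∀ v : ι → k, values (fun j => MvPolynomial.C (P.rep j)) v = P.rep := fun v => by
    funext j; simp [values]
  refine fun x => ⟨0, fun j => MvPolynomial.C (P.rep j), fun j => MvPolynomial.isHomogeneous_C _ _,
    ?_, fun y hy => ?_⟩
  · rw [h]; exact P.rep_nonzero
  · simp only [h, Projectivization.mk_rep]

theorem exists_values_eq_linear [Fintype ι] (A : (ι → k) →ₗ[k] (κ → k)) :
    ∃ G : κ → MvPolynomial ι k, (∀ j, (G j).IsHomogeneous 1) ∧ ∀ v, values G v = A v := by
  classical
  refine ⟨fun j => ∑ i, MvPolynomial.C (A (Pi.single i 1) j) * MvPolynomial.X i,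
    fun j => MvPolynomial.IsHomogeneous.sum _ _ _ fun i _ => ?_, fun v => ?_⟩
  · exact zero_add 1 ▸ (MvPolynomial.isHomogeneous_C _ _).mul (MvPolynomial.isHomogeneous_X _ i)
  · funext j
    conv_rhs => rw [← LinearMap.sum_single_apply (fun _ : ι => k) v]
    simp only [values, map_sum, map_mul, MvPolynomial.eval_C, MvPolynomial.eval_X, Finset.sum_apply]
    refine Finset.sum_congr rfl fun i _ => ?_
    have : Pi.single i (v i) = v i • (Pi.single i 1 : ι → k) := by
      rw [← Pi.single_smul, smul_eq_mul, mul_one]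
    rw [this, map_smul, Pi.smul_apply, smul_eq_mul, mul_comm]

theorem isRegular_of_linear [Fintype ι] {c : X → ℙ k (ι → k)} {g : X → ℙ k (κ → k)}
    (A : (ι → k) →ₗ[k] (κ → k)) (hA : ∀ x, A (c x).rep ≠ 0)
    (hg : ∀ x, g x = Projectivization.mk k _ (hA x)) : IsRegular c g := by
  obtain ⟨G, hG, h⟩ := exists_values_eq_linear A
  refine fun x => ⟨1, G, hG, ?_, fun y hy => ?_⟩
  · rw [h]; exact hA x
  · simp only [h]; exact hg y

theorem exists_values_eq_bilinear [Fintype ι] [Fintype μ]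
    (B : (ι → k) →ₗ[k] (μ → k) →ₗ[k] (κ → k)) :
    ∃ G : κ → MvPolynomial (ι ⊕ μ) k, (∀ j, IsBihomogeneous (G j) 1 1) ∧
      ∀ v w, values G (Sum.elim v w) = B v w := by
  classical
  refine ⟨fun l => ∑ i, ∑ j, MvPolynomial.C (B (Pi.single i 1) (Pi.single j 1) l) *
    (MvPolynomial.X (Sum.inl i) * MvPolynomial.X (Sum.inr j)), fun l => ?_, fun v w => ?_⟩
  · refine Submodule.sum_mem (MvPolynomial.weightedHomogeneousSubmodule k _ _) fun i _ =>
      Submodule.sum_mem _ fun j _ => ?_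
    have h1 := (MvPolynomial.isWeightedHomogeneous_C
      (Sum.elim (fun _ => ((1, 0) : ℕ × ℕ)) (fun _ => ((0, 1) : ℕ × ℕ)))
        (B (Pi.single i 1) (Pi.single j 1) l)).mul
      ((MvPolynomial.isWeightedHomogeneous_X k
      (Sum.elim (fun _ => ((1, 0) : ℕ × ℕ)) (fun _ => ((0, 1) : ℕ × ℕ))) (Sum.inl i : ι ⊕ μ)).mul
      (MvPolynomial.isWeightedHomogeneous_X k
      (Sum.elim (fun _ => ((1, 0) : ℕ × ℕ)) (fun _ => ((0, 1) : ℕ × ℕ))) (Sum.inr j : ι ⊕ μ)))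
    simpa using h1
  · funext l
    conv_rhs => rw [← LinearMap.sum_single_apply (fun _ : ι => k) v,
      ← LinearMap.sum_single_apply (fun _ : μ => k) w]
    have h1 : ∀ i, Pi.single i (v i) = v i • (Pi.single i 1 : ι → k) := fun i => by
      rw [← Pi.single_smul, smul_eq_mul, mul_one]
    have h2 : ∀ i, Pi.single i (w i) = w i • (Pi.single i 1 : μ → k) := fun i => by
      rw [← Pi.single_smul, smul_eq_mul, mul_one]
    simp only [values, map_sum, map_mul, MvPolynomial.eval_C, MvPolynomial.eval_X, Finset.sum_apply,
      h1, h2, map_smul, LinearMap.sum_apply, LinearMap.smul_apply, Pi.smul_apply, Sum.elim_inl,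
      Sum.elim_inr, smul_eq_mul]
    rw [Finset.sum_comm]
    refine Finset.sum_congr rfl fun i _ => ?_
    rw [Finset.mul_sum]
    exact Finset.sum_congr rfl fun j _ => by ring

theorem isRegularOnProduct_of_bilinear [Fintype ι] [Fintype μ] {c₁ : X → ℙ k (ι → k)}
    {c₂ : X → ℙ k (μ → k)} {g : X → ℙ k (κ → k)}
    (h : ∀ x, ∃ B : (ι → k) →ₗ[k] (μ → k) →ₗ[k] (κ → k), B (c₁ x).rep (c₂ x).rep ≠ 0 ∧
      ∀ (y : X) (hy : B (c₁ y).rep (c₂ y).rep ≠ 0), g y = Projectivization.mk k _ hy) :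
    IsRegularOnProduct c₁ c₂ g := by
  intro x
  obtain ⟨B, hB, hg⟩ := h x
  obtain ⟨G, hG, h⟩ := exists_values_eq_bilinear B
  refine ⟨1, 1, G, hG, ?_, fun y hy => ?_⟩
  · rw [h]; exact hB
  · simp only [h] at hy ⊢
    exact hg y hy

theorem exists_rep_affinePoint (s : k) : ∃ a : k, a ≠ 0 ∧ (affinePoint s).rep = a • ![s, 1] :=
  exists_rep_mk_eq_smul _

open Polynomial in
theorem isRegular_of_polynomial [Fintype κ] (P : κ → k[X])
    (h : ∀ s, (fun j => (P j).eval s) ≠ 0) :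
    IsRegular affinePoint (fun s => Projectivization.mk k _ (h s)) := by
  set n := Finset.univ.sup fun j => (P j).natDegree with hn
  have hdeg : ∀ j, (P j).natDegree < n + 1 := fun j =>
    Nat.lt_succ_of_le (Finset.le_sup (f := fun j => (P j).natDegree) (Finset.mem_univ j))
  have hom : ∀ j, (∑ i ∈ Finset.range (n + 1), MvPolynomial.C ((P j).coeff i) *
      (MvPolynomial.X 0 ^ i * MvPolynomial.X 1 ^ (n - i)) :
        MvPolynomial (Fin 2) k).IsHomogeneous n := by
    refine fun j => MvPolynomial.IsHomogeneous.sum _ _ _ fun i hi => ?_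
    have h1 := (MvPolynomial.isHomogeneous_C (Fin 2) ((P j).coeff i)).mul
      (((MvPolynomial.isHomogeneous_X k (0 : Fin 2)).pow i).mul
      ((MvPolynomial.isHomogeneous_X k (1 : Fin 2)).pow (n - i)))
    have h2 : 0 + (1 * i + 1 * (n - i)) = n := by
      have := Finset.mem_range.1 hi
      omega
    rwa [h2] at h1
  have hval : ∀ s : k, values (fun j => ∑ i ∈ Finset.range (n + 1),
      MvPolynomial.C ((P j).coeff i) * (MvPolynomial.X 0 ^ i * MvPolynomial.X 1 ^ (n - i)))
        ![s, 1] = fun j => (P j).eval s := by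
    intro s
    funext j
    rw [eval_eq_sum_range' (hdeg j)]
    simp [values]
  intro s₀
  refine ⟨n, _, hom, ?_, fun s hs => ?_⟩
  · obtain ⟨a, ha, hr⟩ := exists_rep_affinePoint s₀
    rw [hr, values_smul hom, hval]
    exact smul_ne_zero (pow_ne_zero _ ha) (h s₀)
  · obtain ⟨a, ha, hr⟩ := exists_rep_affinePoint s
    have hs' := hs
    simp only [hr, values_smul hom, hval]
    refine (mk_eq_mk_of_eq_smul _ _ rfl).symm

open Polynomial in
/-- A quotient of two linear forms along a regular map from the affine line is a polynomial if the
denominator has no zeros. -/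
theorem exists_polynomial_of_isRegular [IsAlgClosed k] [Fintype κ] {g : k → ℙ k (κ → k)}
    (hg : IsRegular affinePoint g) (w : k → κ → k) (hw : ∀ s, w s ≠ 0)
    (hgw : ∀ s, g s = Projectivization.mk k _ (hw s)) (α γ : (κ → k) →ₗ[k] k)
    (hγ : ∀ s, γ (w s) ≠ 0) : ∃ P : k[X], ∀ s, α (w s) = P.eval s * γ (w s) := by
  classical
  suffices h : ∃ P : k[X], ∀ s, α (w s) / γ (w s) = P.eval s by
    obtain ⟨P, hP⟩ := h
    exact ⟨P, fun s => by rw [← hP, div_mul_cancel₀ _ (hγ s)]⟩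
  refine exists_polynomial_of_locally_rational _ fun s₀ => ?_
  obtain ⟨d, G, hG, h₀, hG'⟩ := hg s₀
  have hlin : ∀ β : (κ → k) →ₗ[k] k, ∃ Q : k[X], ∀ s, Q.eval s = β (values G ![s, 1]) := by
    intro β
    refine ⟨∑ j, C (β (Pi.single j 1)) * MvPolynomial.eval₂ C ![X, 1] (G j), fun s => ?_⟩
    conv_rhs => rw [← LinearMap.sum_single_apply (fun _ : κ => k) (values G ![s, 1])]
    rw [map_sum, eval_finsetSum]
    refine Finset.sum_congr rfl fun j _ => ?_
    have h1 : Pi.single j (values G ![s, 1] j) = values G ![s, 1] j • (Pi.single j 1 : κ → k) := by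
      rw [← Pi.single_smul, smul_eq_mul, mul_one]
    have h2 : (fun i => eval s ((![X, 1] : Fin 2 → k[X]) i)) = ![s, 1] := by
      funext i; fin_cases i <;> simp
    have h3 : (evalRingHom s).comp C = RingHom.id k := by ext; simp
    rw [h1, map_smul, smul_eq_mul, eval_mul, eval_C, mul_comm,
      MvPolynomial.polynomial_eval_eval₂, h2, h3]
    rfl
  obtain ⟨P, hP⟩ := hlin α
  obtain ⟨Q, hQ⟩ := hlin γ
  have hprop : ∀ s, values G ![s, 1] ≠ 0 → ∃ a : k, a ≠ 0 ∧ values G ![s, 1] = a • w s := by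
    intro s hs
    obtain ⟨a, ha, hr⟩ := exists_rep_affinePoint s
    have h1 : values G (affinePoint s).rep ≠ 0 := by
      rw [hr, values_smul hG]; exact smul_ne_zero (pow_ne_zero _ ha) hs
    obtain ⟨b, hb, h2⟩ := exists_eq_smul_of_mk_eq_mk ((hG' s h1).symm.trans (hgw s))
    rw [hr, values_smul hG] at h2
    refine ⟨(a ^ d)⁻¹ * b, mul_ne_zero (inv_ne_zero (pow_ne_zero _ ha)) hb, ?_⟩
    rw [mul_smul, ← h2, inv_smul_smul₀ (pow_ne_zero _ ha)]
  refine ⟨P, Q, ?_, fun s hs => ?_⟩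
  · obtain ⟨a, ha, hr⟩ := exists_rep_affinePoint s₀
    rw [hr, values_smul hG] at h₀
    obtain ⟨b, hb, h1⟩ := hprop s₀ (smul_ne_zero_iff.1 h₀).2
    rw [hQ, h1, map_smul, smul_eq_mul]
    exact mul_ne_zero hb (hγ s₀)
  · rw [hQ] at hs
    obtain ⟨b, hb, h1⟩ := hprop s fun h => hs (by rw [h, map_zero])
    rw [hP, hQ, h1, map_smul, map_smul, smul_eq_mul, smul_eq_mul]
    have := hγ s
    field_simp

end RegularMaps

/-! ### Coordinates adapted to the line -/

section Coordinates

variable {k : Type*} [Field k]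

/-- The form `β(v, w)`, linear in `v` and `q`-Frobenius semilinear in `w`, whose isotropic vectors
are the points of the surface. -/
def form (q : ℕ) (v w : Fin 4 → k) : k :=
  v 0 * w 1 ^ q - v 1 * w 0 ^ q + v 2 * w 3 ^ q - v 3 * w 2 ^ q

/-- The standard Frobenius-sesquilinear form `x₀ y₀^q + x₁ y₁^q` on `k²`. -/
def dot (q : ℕ) (x y : Fin 2 → k) : k := x 0 * y 0 ^ q + x 1 * y 1 ^ q

/-- Coordinates `v ↦ (x, y)` on `k⁴` in which the surface is `x · y^q = y · x^q` and the line
`ker L` is `y = 0`, together with the matrix of `L` in these coordinates. -/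
structure NormalForm (q : ℕ) (L : (Fin 4 → k) →ₗ[k] (Fin 2 → k)) where
  e : (Fin 4 → k) ≃ₗ[k] (Fin 2 → k) × (Fin 2 → k)
  m : (Fin 2 → k) ≃ₗ[k] (Fin 2 → k)
  L_eq : ∀ v, L v = m (e v).2
  form_eq : ∀ v, form q v v = dot q (e v).1 (e v).2 - dot q (e v).2 (e v).1

theorem form_add_left (q : ℕ) (u v w : Fin 4 → k) :
    form q (u + v) w = form q u w + form q v w := by
  simp only [form, Pi.add_apply]; ring

theorem form_smul_left (q : ℕ) (c : k) (v w : Fin 4 → k) :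
    form q (c • v) w = c * form q v w := by
  simp only [form, Pi.smul_apply, smul_eq_mul]; ring

theorem form_smul_right (q : ℕ) (c : k) (v w : Fin 4 → k) :
    form q v (c • w) = c ^ q * form q v w := by
  simp only [form, Pi.smul_apply, smul_eq_mul, mul_pow]; ring

theorem dot_add_left (q : ℕ) (x y z : Fin 2 → k) : dot q (x + y) z = dot q x z + dot q y z := by
  simp only [dot, Pi.add_apply]; ring

theorem dot_smul_left (q : ℕ) (c : k) (x z : Fin 2 → k) : dot q (c • x) z = c * dot q x z := by
  simp only [dot, Pi.smul_apply, smul_eq_mul]; ring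

theorem dot_smul_right (q : ℕ) (c : k) (x z : Fin 2 → k) :
    dot q x (c • z) = c ^ q * dot q x z := by
  simp only [dot, Pi.smul_apply, smul_eq_mul, mul_pow]; ring

section CharP

variable (p : ℕ) [Fact p.Prime] [CharP k p] (a : ℕ)

theorem form_add_right (u v w : Fin 4 → k) :
    form (p ^ a) u (v + w) = form (p ^ a) u v + form (p ^ a) u w := by
  simp only [form, Pi.add_apply, add_pow_expChar_pow]; ring

theorem dot_add_right (x y z : Fin 2 → k) :
    dot (p ^ a) x (y + z) = dot (p ^ a) x y + dot (p ^ a) x z := by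
  simp only [dot, Pi.add_apply, add_pow_expChar_pow]; ring

/-- A subspace on which `v ↦ β(v, v)` vanishes is totally isotropic. -/
theorem form_eq_zero_of_isotropic [Infinite k] (hq : 1 < p ^ a)
    {W : Submodule k (Fin 4 → k)} (hW : ∀ v ∈ W, form (p ^ a) v v = 0) {v w : Fin 4 → k}
    (hv : v ∈ W) (hw : w ∈ W) : form (p ^ a) v w = 0 := by
  refine (eq_zero_of_add_pow_eq_zero hq (A := form (p ^ a) v w) (B := form (p ^ a) w v)
    fun s => ?_).1
  have h := hW _ (W.add_mem (W.smul_mem s hv) hw)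
  rw [form_add_left, form_add_right, form_add_right, form_smul_left, form_smul_left,
    form_smul_right, form_smul_right, hW v hv, hW w hw] at h
  linear_combination h

end CharP

theorem form_self_smul (q : ℕ) (c : k) (v : Fin 4 → k) :
    form q (c • v) (c • v) = c ^ (q + 1) * form q v v := by
  rw [form_smul_left, form_smul_right]; ring

theorem mem_surface_iff {q : ℕ} {P : ℙ k (Fin 4 → k)} : P ∈ surface k q ↔ form q P.rep P.rep = 0 :=
  Iff.rfl

theorem mk_mem_surface_iff {q : ℕ} {v : Fin 4 → k} (hv : v ≠ 0) :
    Projectivization.mk k v hv ∈ surface k q ↔ form q v v = 0 := by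
  obtain ⟨c, hc, h⟩ := exists_rep_mk_eq_smul hv
  rw [mem_surface_iff, h, form_self_smul, mul_eq_zero, or_iff_right (pow_ne_zero _ hc)]

theorem mk_mem_points_iff {W : Submodule k (Fin 4 → k)} {v : Fin 4 → k} (hv : v ≠ 0) :
    Projectivization.mk k v hv ∈ points W ↔ v ∈ W := by
  change (Projectivization.mk k v hv).submodule ≤ W ↔ _
  rw [Projectivization.submodule_mk, Submodule.span_singleton_le_iff_mem]

theorem points_subset_surface_iff {q : ℕ} {W : Submodule k (Fin 4 → k)} (hq : q ≠ 0) :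
    points W ⊆ surface k q ↔ ∀ v ∈ W, form q v v = 0 := by
  refine ⟨fun h v hv => ?_, fun h P hP => ?_⟩
  · by_cases hv0 : v = 0
    · subst hv0; simp [form, hq]
    · exact (mk_mem_surface_iff hv0).1 (h ((mk_mem_points_iff hv0).2 hv))
  · rw [← P.mk_rep] at hP ⊢
    exact (mk_mem_surface_iff _).2 (h _ ((mk_mem_points_iff _).1 hP))

/-- A plane in `k⁴` has a basis `w₀, w₁` in echelon form: two coordinates of `k⁴` restrict to its
dual basis. -/
theorem exists_echelon_basis {W : Submodule k (Fin 4 → k)} (hW : Module.finrank k W = 2) :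
    ∃ (i₀ i₁ : Fin 4) (w₀ w₁ : Fin 4 → k), w₀ ∈ W ∧ w₁ ∈ W ∧ w₀ i₀ = 1 ∧ w₀ i₁ = 0 ∧ w₁ i₀ = 0 ∧
      w₁ i₁ = 1 ∧ ∀ v ∈ W, v = v i₀ • w₀ + v i₁ • w₁ := by
  obtain ⟨v, hv, hv0⟩ := W.exists_mem_ne_zero_of_ne_bot fun h => by
    rw [h, finrank_bot] at hW; omega
  obtain ⟨i₀, hi₀⟩ := Function.ne_iff.1 hv0
  simp only [Pi.zero_apply] at hi₀
  obtain ⟨u, hu, huv⟩ : ∃ u ∈ W, u ∉ Submodule.span k {v} := by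
    by_contra! h
    have := Submodule.finrank_mono (show W ≤ Submodule.span k {v} from h)
    rw [hW, finrank_span_singleton hv0] at this
    omega
  obtain ⟨u', hu', hu'0, hui⟩ : ∃ u' ∈ W, u' ≠ 0 ∧ u' i₀ = 0 := by
    refine ⟨u - (u i₀ / v i₀) • v, W.sub_mem hu (W.smul_mem _ hv), fun h => huv ?_, ?_⟩
    · rw [sub_eq_zero.1 h]
      exact Submodule.smul_mem _ _ (Submodule.mem_span_singleton_self v)
    · simp [div_mul_cancel₀ _ hi₀]
  obtain ⟨i₁, hi₁⟩ := Function.ne_iff.1 hu'0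
  simp only [Pi.zero_apply] at hi₁
  set w₁ := (u' i₁)⁻¹ • u' with hw₁
  set w₀ := (v i₀)⁻¹ • v - ((v i₀)⁻¹ * v i₁) • w₁ with hw₀
  have h10 : w₁ i₀ = 0 := by simp [hw₁, hui]
  have h11 : w₁ i₁ = 1 := by simp [hw₁, hi₁]
  have h00 : w₀ i₀ = 1 := by simp [hw₀, h10, hi₀]
  have h01 : w₀ i₁ = 0 := by simp [hw₀, h11]
  have hw₁W : w₁ ∈ W := W.smul_mem _ hu'
  have hw₀W : w₀ ∈ W := W.sub_mem (W.smul_mem _ hv) (W.smul_mem _ hw₁W)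
  refine ⟨i₀, i₁, w₀, w₁, hw₀W, hw₁W, h00, h01, h10, h11, ?_⟩
  have hli : LinearIndependent k ![w₀, w₁] := by
    rw [LinearIndependent.pair_iff]
    intro s t h
    have h1 := congrFun h i₀
    have h2 := congrFun h i₁
    simp [h00, h10, h01, h11] at h1 h2
    exact ⟨h1, h2⟩
  have hspan : Submodule.span k (Set.range ![w₀, w₁]) = W := by
    refine Submodule.eq_of_le_of_finrank_eq ?_ ?_
    · rw [Submodule.span_le]
      rintro _ ⟨i, rfl⟩
      fin_cases i
      exacts [hw₀W, hw₁W]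
    · rw [finrank_span_eq_card hli, hW]; rfl
  intro z hz
  rw [← hspan, Matrix.range_cons, Matrix.range_cons, Matrix.range_empty, Set.union_empty,
    Set.singleton_union, Submodule.mem_span_pair] at hz
  obtain ⟨s, t, rfl⟩ := hz
  simp [h00, h10, h01, h11]

theorem exists_form_eq_neg_coord (q : ℕ) (i : Fin 4) :
    ∃ u : Fin 4 → k, ∀ v, form q u v = -v i ^ q := by
  fin_cases i
  · exact ⟨![0, 1, 0, 0], fun v => by simp [form]⟩
  · exact ⟨![-1, 0, 0, 0], fun v => by simp [form]⟩
  · exact ⟨![0, 0, 0, 1], fun v => by simp [form]⟩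
  · exact ⟨![0, 0, -1, 0], fun v => by simp [form]⟩

variable (p : ℕ) [Fact p.Prime] [CharP k p] (a : ℕ)

/-- Swapping the arguments of `β` amounts to a Frobenius twist. -/
theorem form_pow_eq_neg (v w : Fin 4 → k) :
    form (p ^ a) v w ^ p ^ a = -form (p ^ a) (fun i => w i ^ (p ^ a) ^ 2) v := by
  simp only [form, sub_pow_expChar_pow, add_pow_expChar_pow, mul_pow, ← pow_mul, sq]
  ring

/-- The adapted coordinates exist for every line on the surface. The plane `W = ker L` is its own
orthogonal space up to Frobenius, hence it is stable under the `q²`-Frobenius, so the vectors of its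
echelon basis have coordinates in the field with `q²` elements. This makes the matrices of `β` on
`W × U` and on `U × W`, for dual vectors spanning `U`, standard at the same time; correcting `U` by
elements of `W` then makes `U` isotropic. -/
theorem exists_normalForm [IsAlgClosed k] (ha : 0 < a) (L : (Fin 4 → k) →ₗ[k] (Fin 2 → k))
    (hL : IsLineOnSurface (p ^ a) (LinearMap.ker L)) : Nonempty (NormalForm (p ^ a) L) := by
  have hq : 1 < p ^ a := Nat.one_lt_pow ha.ne' (Fact.out : p.Prime).one_lt
  have hqq : 1 < (p ^ a) ^ 2 := Nat.one_lt_pow two_ne_zero hq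
  have hq0 : p ^ a ≠ 0 := by omega
  have zq : (0 : k) ^ p ^ a = 0 := zero_pow hq0
  have zqq : (0 : k) ^ (p ^ a) ^ 2 = 0 := zero_pow (by omega)
  obtain ⟨hW, hWS⟩ := hL
  set W := LinearMap.ker L with hWdef
  have hiso : ∀ {v w : Fin 4 → k}, v ∈ W → w ∈ W → form (p ^ a) v w = 0 :=
    form_eq_zero_of_isotropic p a hq ((points_subset_surface_iff hq0).1 hWS)
  obtain ⟨i₀, i₁, w₀, w₁, hw₀, hw₁, h00, h01, h10, h11, hexp⟩ := exists_echelon_basis hW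
  obtain ⟨u₀, hu₀⟩ := exists_form_eq_neg_coord (k := k) (p ^ a) i₀
  obtain ⟨u₁, hu₁⟩ := exists_form_eq_neg_coord (k := k) (p ^ a) i₁
  let T : (Fin 4 → k) →ₗ[k] (Fin 2 → k) :=
    { toFun := fun u => ![form (p ^ a) u w₀, form (p ^ a) u w₁]
      map_add' := fun u v => by simp [form_add_left]
      map_smul' := fun c u => by simp [form_smul_left] }
  have hT : ∀ u, T u = ![form (p ^ a) u w₀, form (p ^ a) u w₁] := fun _ => rfl
  have hTs : Function.Surjective T := by
    intro y
    refine ⟨-(y 0 • u₀ + y 1 • u₁), ?_⟩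
    rw [map_neg, map_add, map_smul, map_smul, hT, hT, hu₀, hu₀, hu₁, hu₁, h00, h01, h10, h11]
    funext i
    fin_cases i <;> simp [zq]
  have hkT : W = LinearMap.ker T := by
    refine Submodule.eq_of_le_of_finrank_eq (fun v hv => ?_) ?_
    · rw [LinearMap.mem_ker, hT, hiso hv hw₀, hiso hv hw₁]
      simp
    · have := LinearMap.finrank_range_add_finrank_ker T
      rw [LinearMap.range_eq_top.2 hTs, finrank_top] at this
      simp at this
      omega
  -- the `q²`-Frobenius preserves `W` and therefore fixes `w₀` and `w₁`
  have hFW : ∀ w ∈ W, (fun i => w i ^ (p ^ a) ^ 2) ∈ W := by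
    intro w hw
    rw [hkT, LinearMap.mem_ker, hT]
    have h : ∀ v ∈ W, form (p ^ a) (fun i => w i ^ (p ^ a) ^ 2) v = 0 := fun v hv => by
      rw [← neg_eq_zero, ← form_pow_eq_neg, hiso hv hw, zero_pow hq0]
    rw [h _ hw₀, h _ hw₁]
    simp
  have hF₀ : (fun i => w₀ i ^ (p ^ a) ^ 2) = w₀ := by
    rw [hexp _ (hFW _ hw₀), h00, h01]; simp [zqq]
  have hF₁ : (fun i => w₁ i ^ (p ^ a) ^ 2) = w₁ := by
    rw [hexp _ (hFW _ hw₁), h10, h11]; simp [zqq]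
  have hsw : ∀ u w : Fin 4 → k, (fun i => w i ^ (p ^ a) ^ 2) = w →
      form (p ^ a) w u = -form (p ^ a) u w ^ p ^ a := by
    intro u w hw
    rw [form_pow_eq_neg, hw, neg_neg]
  have hneg : (-1 : k) ^ p ^ a = -1 := by
    have := sub_pow_expChar_pow (0 : k) 1 a (p := p)
    rwa [zq, one_pow, zero_sub] at this
  have u0w0 : form (p ^ a) u₀ w₀ = -1 := by rw [hu₀, h00]; simp
  have u0w1 : form (p ^ a) u₀ w₁ = 0 := by rw [hu₀, h10, zq, neg_zero]
  have u1w0 : form (p ^ a) u₁ w₀ = 0 := by rw [hu₁, h01, zq, neg_zero]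
  have u1w1 : form (p ^ a) u₁ w₁ = -1 := by rw [hu₁, h11]; simp
  have w0u0 : form (p ^ a) w₀ u₀ = 1 := by rw [hsw _ _ hF₀, u0w0, hneg, neg_neg]
  have w1u0 : form (p ^ a) w₁ u₀ = 0 := by rw [hsw _ _ hF₁, u0w1, zero_pow hq0, neg_zero]
  have w0u1 : form (p ^ a) w₀ u₁ = 0 := by rw [hsw _ _ hF₀, u1w0, zero_pow hq0, neg_zero]
  have w1u1 : form (p ^ a) w₁ u₁ = 1 := by rw [hsw _ _ hF₁, u1w1, hneg, neg_neg]
  have w0w0 := hiso hw₀ hw₀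
  have w0w1 := hiso hw₀ hw₁
  have w1w0 := hiso hw₁ hw₀
  have w1w1 := hiso hw₁ hw₁
  -- the correction of `u₀, u₁` by elements of `W` that makes their span isotropic
  obtain ⟨c₀₀, hc₀₀⟩ := exists_sub_pow_eq hq (-form (p ^ a) u₀ u₀)
  obtain ⟨c₁₁, hc₁₁⟩ := exists_sub_pow_eq hq (-form (p ^ a) u₁ u₁)
  obtain ⟨c₁₀, hc₁₀⟩ := exists_sub_pow_eq hqq (-form (p ^ a) u₁ u₀ - form (p ^ a) u₀ u₁ ^ p ^ a)
  obtain ⟨c₀₁, hc₀₁⟩ : ∃ c, c = c₁₀ ^ p ^ a - form (p ^ a) u₀ u₁ := ⟨_, rfl⟩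
  have hc₀₁' : c₁₀ - c₀₁ ^ p ^ a = -form (p ^ a) u₁ u₀ := by
    rw [hc₀₁, sub_pow_expChar_pow, ← pow_mul, ← sq]
    linear_combination hc₁₀
  let Ψ : (Fin 2 → k) × (Fin 2 → k) →ₗ[k] (Fin 4 → k) :=
    { toFun := fun z => z.1 0 • w₀ + z.1 1 • w₁ + z.2 0 • (u₀ + c₀₀ • w₀ + c₀₁ • w₁)
        + z.2 1 • (u₁ + c₁₀ • w₀ + c₁₁ • w₁)
      map_add' := fun y z => by simp only [Prod.fst_add, Prod.snd_add, Pi.add_apply]; module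
      map_smul' := fun c z => by
        simp only [Prod.smul_fst, Prod.smul_snd, Pi.smul_apply, smul_eq_mul, RingHom.id_apply]
        module }
  have hΨ : ∀ z, Ψ z = z.1 0 • w₀ + z.1 1 • w₁ + z.2 0 • (u₀ + c₀₀ • w₀ + c₀₁ • w₁)
        + z.2 1 • (u₁ + c₁₀ • w₀ + c₁₁ • w₁) := fun _ => rfl
  have hform : ∀ z, form (p ^ a) (Ψ z) (Ψ z) = dot (p ^ a) z.1 z.2 - dot (p ^ a) z.2 z.1 := by
    intro z
    rw [hΨ]
    simp only [form_add_left, form_add_right, form_smul_left, form_smul_right, u0w0, u0w1, u1w0,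
      u1w1, w0u0, w1u0, w0u1, w1u1, w0w0, w0w1, w1w0, w1w1, dot]
    linear_combination z.2 0 * z.2 0 ^ p ^ a * hc₀₀ + z.2 1 * z.2 1 ^ p ^ a * hc₁₁ +
      z.2 0 * z.2 1 ^ p ^ a * hc₀₁ + z.2 1 * z.2 0 ^ p ^ a * hc₀₁'
  have hTΨ : ∀ z, T (Ψ z) = -z.2 := by
    intro z
    rw [hT, hΨ]
    simp only [form_add_left, form_smul_left, u0w0, u0w1, u1w0, u1w1, w0w0, w0w1, w1w0, w1w1]
    funext i
    fin_cases i <;> simp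
  have hΨi : Function.Injective Ψ := by
    rw [← LinearMap.ker_eq_bot, LinearMap.ker_eq_bot']
    intro z hz
    have h2 : z.2 = 0 := by rw [← neg_eq_zero, ← hTΨ, hz, map_zero]
    rw [hΨ, h2] at hz
    have h3 := congrFun hz i₀
    have h4 := congrFun hz i₁
    simp [h00, h01, h10, h11] at h3 h4
    refine Prod.ext ?_ h2
    funext i
    fin_cases i
    exacts [h3, h4]
  have hdim : Module.finrank k ((Fin 2 → k) × (Fin 2 → k)) = Module.finrank k (Fin 4 → k) := by
    simp
  let E := LinearMap.linearEquivOfInjective Ψ hΨi hdim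
  have hE : ∀ z, E z = Ψ z := fun z => LinearMap.linearEquivOfInjective_apply ..
  have hLΨ : ∀ z, L (Ψ z) = 0 ↔ z.2 = 0 := by
    intro z
    rw [← LinearMap.mem_ker, ← hWdef, hkT, LinearMap.mem_ker, hTΨ, neg_eq_zero]
  let M : (Fin 2 → k) →ₗ[k] (Fin 2 → k) := L ∘ₗ Ψ ∘ₗ LinearMap.inr k _ _
  have hM : ∀ y, M y = L (Ψ (0, y)) := fun _ => rfl
  have hMi : Function.Injective M := by
    rw [← LinearMap.ker_eq_bot, LinearMap.ker_eq_bot']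
    intro y hy
    rw [hM, hLΨ] at hy
    exact hy
  refine ⟨⟨E.symm, LinearEquiv.ofInjectiveEndo M hMi, fun v => ?_, fun v => ?_⟩⟩
  · obtain ⟨z, rfl⟩ := E.surjective v
    rw [E.symm_apply_apply, hE, LinearEquiv.coe_ofInjectiveEndo, hM, ← sub_eq_zero, ← map_sub,
      ← map_sub, hLΨ]
    simp
  · obtain ⟨z, rfl⟩ := E.surjective v
    rw [E.symm_apply_apply, hE, hform]

end Coordinates

/-! ### The fibres as additive groups, and the group scheme structure -/

section Fibres

variable {k : Type*} [Field k]

namespace NormalForm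

variable {q : ℕ} {L : (Fin 4 → k) →ₗ[k] (Fin 2 → k)} (D : NormalForm q L)

/-- The value of the coordinate `y` on the fibre over `t`, normalised by the chosen representative
of `t`. -/
noncomputable def dir (t : ℙ k (Fin 2 → k)) : Fin 2 → k := D.m.symm t.rep

theorem dir_ne_zero (t : ℙ k (Fin 2 → k)) : D.dir t ≠ 0 :=
  (LinearEquiv.map_ne_zero_iff _).2 t.rep_nonzero

theorem symm_ne_zero (x : Fin 2 → k) {τ : Fin 2 → k} (hτ : τ ≠ 0) : D.e.symm (x, τ) ≠ 0 :=
  (LinearEquiv.map_ne_zero_iff _).2 fun h => hτ (congrArg Prod.snd h)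

theorem exists_dir_mk_eq_smul {τ : Fin 2 → k} (h : D.m τ ≠ 0) :
    ∃ c : k, c ≠ 0 ∧ D.dir (Projectivization.mk k (D.m τ) h) = c • τ := by
  obtain ⟨c, hc, hr⟩ := exists_rep_mk_eq_smul h
  exact ⟨c, hc, by rw [dir, hr, map_smul, LinearEquiv.symm_apply_apply]⟩

theorem mk_eq_of_dir {t : ℙ k (Fin 2 → k)} {τ : Fin 2 → k} (h : D.m τ ≠ 0) {c : k}
    (ht : D.dir t = c • τ) : t = Projectivization.mk k (D.m τ) h := by
  rw [← t.mk_rep]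
  refine mk_eq_mk_of_eq_smul (a := c) _ _ ?_
  rw [← map_smul, ← ht, dir, LinearEquiv.apply_symm_apply]

theorem exists_coord {t : ℙ k (Fin 2 → k)} (P : Fibre q L t) :
    ∃ x, P.pt = Projectivization.mk k _ (D.symm_ne_zero x (D.dir_ne_zero t)) ∧
      dot q x (D.dir t) = dot q (D.dir t) x := by
  obtain ⟨⟨P, hS, hP⟩, rfl⟩ := P
  set t := pencil q L ⟨P, hS, hP⟩ with ht
  obtain ⟨c, hc, h⟩ := exists_eq_smul_of_mk_eq_mk (hw := t.rep_nonzero) (ht.symm.trans t.mk_rep.symm)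
  have h2 : (D.e P.rep).2 = c • D.dir t := by
    rw [dir, ← map_smul, ← h]
    change _ = D.m.symm (L P.rep)
    rw [D.L_eq, LinearEquiv.symm_apply_apply]
  have h3 : P.rep = c • D.e.symm (c⁻¹ • (D.e P.rep).1, D.dir t) := by
    rw [← map_smul, Prod.smul_mk, smul_inv_smul₀ hc, ← h2]
    exact (D.e.symm_apply_apply _).symm
  have h4 : P = Projectivization.mk k _
      (D.symm_ne_zero (c⁻¹ • (D.e P.rep).1) (D.dir_ne_zero t)) := by
    conv_lhs => rw [← P.mk_rep]
    exact mk_eq_mk_of_eq_smul _ _ h3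
  refine ⟨_, h4, ?_⟩
  have h5 := hS
  rw [h4, mk_mem_surface_iff, D.form_eq, LinearEquiv.apply_symm_apply, sub_eq_zero] at h5
  exact h5

/-- The coordinate `x` of a point of the fibre over `t`, the coordinate `y` being `dir t`. -/
noncomputable def coord {t : ℙ k (Fin 2 → k)} (P : Fibre q L t) : Fin 2 → k :=
  (D.exists_coord P).choose

theorem pt_eq {t : ℙ k (Fin 2 → k)} (P : Fibre q L t) :
    P.pt = Projectivization.mk k _ (D.symm_ne_zero (D.coord P) (D.dir_ne_zero t)) :=
  (D.exists_coord P).choose_spec.1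

theorem coord_eqn {t : ℙ k (Fin 2 → k)} (P : Fibre q L t) :
    dot q (D.coord P) (D.dir t) = dot q (D.dir t) (D.coord P) :=
  (D.exists_coord P).choose_spec.2

theorem exists_rep_eq_smul {t : ℙ k (Fin 2 → k)} (P : Fibre q L t) :
    ∃ c : k, c ≠ 0 ∧ P.pt.rep = c • D.e.symm (D.coord P, D.dir t) := by
  rw [D.pt_eq P]
  exact exists_rep_mk_eq_smul _

theorem coord_eq_of_pt_eq {t : ℙ k (Fin 2 → k)} {P : Fibre q L t} {x : Fin 2 → k}
    (h : P.pt = Projectivization.mk k _ (D.symm_ne_zero x (D.dir_ne_zero t))) : D.coord P = x := by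
  obtain ⟨c, hc, h1⟩ := exists_eq_smul_of_mk_eq_mk ((D.pt_eq P).symm.trans h)
  rw [← map_smul] at h1
  have h2 := D.e.symm.injective h1
  have h3 : D.dir t = c • D.dir t := congrArg Prod.snd h2
  obtain ⟨j, hj⟩ := Function.ne_iff.1 (D.dir_ne_zero t)
  have h4 : c = 1 := by
    have := congrFun h3 j
    simp only [Pi.smul_apply, smul_eq_mul] at this
    exact (mul_eq_right₀ hj).1 this.symm
  have h5 : D.coord P = c • x := congrArg Prod.fst h2
  rw [h5, h4, one_smul]

theorem fibre_ext_pt {t : ℙ k (Fin 2 → k)} {P P' : Fibre q L t} (h : P.pt = P'.pt) : P = P' :=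
  Subtype.ext (Subtype.ext h)

theorem coord_injective (t : ℙ k (Fin 2 → k)) :
    Function.Injective (D.coord : Fibre q L t → Fin 2 → k) := by
  intro P P' h
  refine fibre_ext_pt ?_
  rw [D.pt_eq P, D.pt_eq P']
  simp only [h]

/-- The point of the fibre over `t` with coordinate `x`. -/
noncomputable def fibrePoint (t : ℙ k (Fin 2 → k)) (x : Fin 2 → k)
    (h : dot q x (D.dir t) = dot q (D.dir t) x) : Fibre q L t :=
  have hL : L (D.e.symm (x, D.dir t)) = t.rep := by
    rw [D.L_eq, LinearEquiv.apply_symm_apply, dir, LinearEquiv.apply_symm_apply]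
  ⟨⟨Projectivization.mk k _ (D.symm_ne_zero x (D.dir_ne_zero t)),
    (mk_mem_surface_iff _).2 (by rw [D.form_eq, LinearEquiv.apply_symm_apply, h, sub_self]),
    fun hk => t.rep_nonzero (by
      rw [← hL]; exact LinearMap.mem_ker.1 ((mk_mem_points_iff _).1 hk))⟩, by
    obtain ⟨c, hc, hr⟩ := exists_rep_mk_eq_smul (D.symm_ne_zero x (D.dir_ne_zero t))
    refine (mk_eq_mk_of_eq_smul (a := c) _ t.rep_nonzero ?_).trans t.mk_rep
    rw [hr, map_smul, hL]⟩

theorem pt_fibrePoint (t : ℙ k (Fin 2 → k)) (x : Fin 2 → k)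
    (h : dot q x (D.dir t) = dot q (D.dir t) x) : (D.fibrePoint t x h).pt =
      Projectivization.mk k _ (D.symm_ne_zero x (D.dir_ne_zero t)) := rfl

theorem coord_fibrePoint (t : ℙ k (Fin 2 → k)) (x : Fin 2 → k)
    (h : dot q x (D.dir t) = dot q (D.dir t) x) : D.coord (D.fibrePoint t x h) = x :=
  D.coord_eq_of_pt_eq (D.pt_fibrePoint t x h)

/-- The bilinear map that gives the addition of the coordinates `x` near the points where `y j` does
not vanish. -/
noncomputable def addMap (j : Fin 2) : (Fin 4 → k) →ₗ[k] (Fin 4 → k) →ₗ[k] (Fin 4 → k) :=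
  LinearMap.mk₂ k (fun v w => D.e.symm
    ((D.e w).2 j • (D.e v).1 + (D.e v).2 j • (D.e w).1, (D.e w).2 j • (D.e v).2))
    (fun u v w => by
      rw [← map_add]; congr 1
      simp only [map_add, Prod.fst_add, Prod.snd_add, Pi.add_apply, Prod.mk_add_mk]
      congr 1 <;> module)
    (fun c v w => by
      rw [← map_smul]; congr 1
      simp only [map_smul, Prod.smul_fst, Prod.smul_snd, Pi.smul_apply, Prod.smul_mk, smul_eq_mul]
      congr 1 <;> module)
    (fun u v w => by
      rw [← map_add]; congr 1
      simp only [map_add, Prod.fst_add, Prod.snd_add, Pi.add_apply, Prod.mk_add_mk]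
      congr 1 <;> module)
    (fun c v w => by
      rw [← map_smul]; congr 1
      simp only [map_smul, Prod.smul_fst, Prod.smul_snd, Pi.smul_apply, Prod.smul_mk, smul_eq_mul]
      congr 1 <;> module)

theorem addMap_apply (j : Fin 2) (c c' : k) (x x' τ τ' : Fin 2 → k) :
    D.addMap j (c • D.e.symm (x, τ)) (c' • D.e.symm (x', τ')) =
      (c * c') • D.e.symm (τ' j • x + τ j • x', τ' j • τ) := by
  rw [map_smul, map_smul, LinearMap.smul_apply, smul_smul, mul_comm c']
  simp [addMap]

end NormalForm

section CharP

variable (p : ℕ) [Fact p.Prime] [CharP k p] (a : ℕ)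

/-- The additive group `{x : x · τ^q = τ · x^q}`. -/
def solutions (τ : Fin 2 → k) : AddSubgroup (Fin 2 → k) where
  carrier := {x | dot (p ^ a) x τ = dot (p ^ a) τ x}
  zero_mem' := by
    have : (0 : k) ^ p ^ a = 0 := zero_pow (pow_ne_zero _ (Fact.out : p.Prime).ne_zero)
    simp [dot, this]
  add_mem' {x y} hx hy := by
    simp only [Set.mem_ofPred_eq] at hx hy ⊢
    rw [dot_add_left, dot_add_right, hx, hy]
  neg_mem' {x} hx := by
    have h0 : dot (p ^ a) τ 0 = 0 := by
      have : (0 : k) ^ p ^ a = 0 := zero_pow (pow_ne_zero _ (Fact.out : p.Prime).ne_zero)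
      simp [dot, this]
    have h1 := dot_add_right p a τ x (-x)
    have h2 := dot_smul_left (p ^ a) (-1) x τ
    rw [neg_one_smul] at h2
    rw [add_neg_cancel, h0] at h1
    simp only [Set.mem_ofPred_eq] at hx ⊢
    rw [h2, hx]
    linear_combination h1

variable {p a}

namespace NormalForm

variable {L : (Fin 4 → k) →ₗ[k] (Fin 2 → k)} (D : NormalForm (p ^ a) L)

/-- The coordinate `x` identifies the fibre over `t` with the additive group of solutions. -/
noncomputable def fibreEquiv (t : ℙ k (Fin 2 → k)) :
    Fibre (p ^ a) L t ≃ Multiplicative (solutions p a (D.dir t)) where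
  toFun P := Multiplicative.ofAdd ⟨D.coord P, D.coord_eqn P⟩
  invFun x := D.fibrePoint t x.toAdd.1 x.toAdd.2
  left_inv _ := D.coord_injective t (D.coord_fibrePoint t _ _)
  right_inv _ := Multiplicative.toAdd.injective (Subtype.ext (D.coord_fibrePoint t _ _))

/-- The group law on a fibre given by the addition of the coordinate `x`. -/
@[reducible]
noncomputable def fibreGroup (t : ℙ k (Fin 2 → k)) : Group (Fibre (p ^ a) L t) :=
  (D.fibreEquiv t).group

theorem coord_mul (t : ℙ k (Fin 2 → k)) (P P' : Fibre (p ^ a) L t) :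
    D.coord ((D.fibreGroup t).mul P P') = D.coord P + D.coord P' :=
  D.coord_fibrePoint t _ (D.fibreEquiv t P * D.fibreEquiv t P').toAdd.2

theorem coord_inv (t : ℙ k (Fin 2 → k)) (P : Fibre (p ^ a) L t) :
    D.coord ((D.fibreGroup t).inv P) = -D.coord P :=
  D.coord_fibrePoint t _ (D.fibreEquiv t P)⁻¹.toAdd.2

theorem coord_one (t : ℙ k (Fin 2 → k)) : D.coord (D.fibreGroup t).one = 0 :=
  D.coord_fibrePoint t _ (1 : Multiplicative (solutions p a (D.dir t))).toAdd.2

/-- The group scheme structure given by the addition of the coordinate `x`. -/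
@[reducible]
noncomputable def pencilGroup : PencilGroup (p ^ a) L where
  grp := D.fibreGroup
  regular_mul := by
    refine isRegularOnProduct_of_bilinear fun z₀ => ?_
    obtain ⟨j, hj⟩ := Function.ne_iff.1 (D.dir_ne_zero z₀.1)
    have key : ∀ z : Σ t, Fibre (p ^ a) L t × Fibre (p ^ a) L t, ∃ c : k, c ≠ 0 ∧
        D.addMap j z.2.1.pt.rep z.2.2.pt.rep =
          (c * D.dir z.1 j) • D.e.symm (D.coord z.2.1 + D.coord z.2.2, D.dir z.1) := by
      rintro ⟨t, P, P'⟩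
      obtain ⟨c, hc, h⟩ := D.exists_rep_eq_smul P
      obtain ⟨c', hc', h'⟩ := D.exists_rep_eq_smul P'
      refine ⟨c * c', mul_ne_zero hc hc', ?_⟩
      simp only [h, h', addMap_apply]
      rw [← smul_add, ← Prod.smul_mk, map_smul, smul_smul]
    refine ⟨D.addMap j, ?_, fun z hz => ?_⟩
    · obtain ⟨c, hc, h⟩ := key z₀
      rw [h]
      exact smul_ne_zero (mul_ne_zero hc hj) (D.symm_ne_zero _ (D.dir_ne_zero _))
    · obtain ⟨c, hc, h⟩ := key z
      rw [← D.coord_mul] at h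
      rw [D.pt_eq]
      exact (mk_eq_mk_of_eq_smul _ _ h).symm
  regular_inv := by
    let A : (Fin 4 → k) →ₗ[k] (Fin 4 → k) := D.e.symm.toLinearMap ∘ₗ
      LinearMap.prodMap (-LinearMap.id) LinearMap.id ∘ₗ D.e.toLinearMap
    have key : ∀ z : Σ t, Fibre (p ^ a) L t, ∃ c : k, c ≠ 0 ∧
        A z.2.pt.rep = c • D.e.symm (-D.coord z.2, D.dir z.1) := by
      intro z
      obtain ⟨c, hc, h⟩ := D.exists_rep_eq_smul z.2
      exact ⟨c, hc, by rw [h, map_smul]; simp [A]⟩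
    refine isRegular_of_linear A (fun z => ?_) fun z => ?_
    · obtain ⟨c, hc, h⟩ := key z
      rw [h]
      exact smul_ne_zero hc (D.symm_ne_zero _ (D.dir_ne_zero _))
    · obtain ⟨c, hc, h⟩ := key z
      rw [← D.coord_inv] at h
      rw [D.pt_eq]
      exact (mk_eq_mk_of_eq_smul _ _ h).symm
  regular_one := by
    let A : (Fin 2 → k) →ₗ[k] (Fin 4 → k) := D.e.symm.toLinearMap ∘ₗ
      LinearMap.inr k _ _ ∘ₗ D.m.symm.toLinearMap
    have key : ∀ t : ℙ k (Fin 2 → k), A t.rep = D.e.symm (0, D.dir t) := fun t => rfl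
    refine isRegular_of_linear A (fun t => ?_) fun t => ?_
    · rw [key]; exact D.symm_ne_zero _ (D.dir_ne_zero _)
    · rw [D.pt_eq]
      refine mk_eq_mk_of_eq_smul (a := 1) _ _ ?_
      rw [one_smul, key, ← D.coord_one]
      rfl

end NormalForm

end CharP

end Fibres

/-! ### Singular and nonsingular fibres -/

section SingularFibres

open Polynomial

variable {k : Type*} [Field k]

/-- The vectors `τ` that are proportional to their `q²`-Frobenius transform. -/
def IsDegenerate (q : ℕ) (τ : Fin 2 → k) : Prop := τ 0 ^ q ^ 2 * τ 1 = τ 1 ^ q ^ 2 * τ 0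

theorem isDegenerate_smul_iff (q : ℕ) {c : k} (hc : c ≠ 0) (τ : Fin 2 → k) :
    IsDegenerate q (c • τ) ↔ IsDegenerate q τ := by
  have h : c ^ q ^ 2 * c ≠ 0 := mul_ne_zero (pow_ne_zero _ hc) hc
  simp only [IsDegenerate, Pi.smul_apply, smul_eq_mul, mul_pow]
  rw [show c ^ q ^ 2 * τ 0 ^ q ^ 2 * (c * τ 1) = (c ^ q ^ 2 * c) * (τ 0 ^ q ^ 2 * τ 1) by ring,
    show c ^ q ^ 2 * τ 1 ^ q ^ 2 * (c * τ 0) = (c ^ q ^ 2 * c) * (τ 1 ^ q ^ 2 * τ 0) by ring,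
    mul_right_inj' h]

theorem exists_polynomial_eval_curve {ι : Type*} (W : ι → k[X]) (G : MvPolynomial ι k) :
    ∃ Q : k[X], ∀ s, Q.eval s = MvPolynomial.eval (fun i => (W i).eval s) G := by
  refine ⟨MvPolynomial.eval₂ C W G, fun s => ?_⟩
  have h : (evalRingHom s).comp C = RingHom.id k := by ext; simp
  rw [MvPolynomial.polynomial_eval_eval₂, h]
  rfl

theorem exists_roots [IsAlgClosed k] {n : ℕ} (hn : 0 < n) (τ : Fin 2 → k) :
    ∃ c : Fin 2 → k, ∀ i, c i ^ n = τ i :=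
  ⟨_, fun i => (IsAlgClosed.exists_pow_nat_eq (τ i) hn).choose_spec⟩

section CharP

variable {p : ℕ} [Fact p.Prime] [CharP k p] {a : ℕ}

theorem isDegenerate_iff {τ c : Fin 2 → k} (hc : ∀ i, c i ^ p ^ a = τ i) :
    IsDegenerate (p ^ a) τ ↔ c 0 * τ 1 ^ p ^ a = c 1 * τ 0 ^ p ^ a := by
  have h : c 0 * τ 1 ^ p ^ a = c 1 * τ 0 ^ p ^ a ↔
      (c 0 * τ 1 ^ p ^ a) ^ p ^ a = (c 1 * τ 0 ^ p ^ a) ^ p ^ a :=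
    (iterateFrobenius_inj k p a).eq_iff.symm
  rw [h, mul_pow, mul_pow, hc, hc, ← pow_mul, ← pow_mul, ← sq, IsDegenerate, eq_comm, mul_comm,
    mul_comm (τ 0 ^ _)]

/-- If `τ` is not degenerate, then the linear forms `τ^q` and `c = τ^{1/q}` are coordinates on `k²`
in which the solutions of `τ^q · x = (c · x)^q` are the graph of a function of `V = c · x`. -/
theorem exists_affine_coordinate [IsAlgClosed k] {τ : Fin 2 → k} (hτ : ¬ IsDegenerate (p ^ a) τ) :
    ∃ (V : (Fin 2 → k) →ₗ[k] k) (P : Fin 2 → k[X]),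
      (∀ s, (fun i => (P i).eval s) ∈ solutions p a τ ∧ V (fun i => (P i).eval s) = s) ∧
      ∀ x ∈ solutions p a τ, ∀ i, (P i).eval (V x) = x i := by
  obtain ⟨c, hc⟩ := exists_roots (pow_pos (Fact.out : p.Prime).pos a) τ
  rw [isDegenerate_iff hc] at hτ
  set δ := c 0 * τ 1 ^ p ^ a - c 1 * τ 0 ^ p ^ a with hδ
  have hδ0 : δ ≠ 0 := sub_ne_zero.2 hτ
  let V : (Fin 2 → k) →ₗ[k] k :=
    c 0 • LinearMap.proj (R := k) (φ := fun _ => k) 0 + c 1 • LinearMap.proj (φ := fun _ => k) 1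
  have hV : ∀ x, V x = c 0 * x 0 + c 1 * x 1 := fun x => rfl
  have hmem : ∀ x, x ∈ solutions p a τ ↔ x 0 * τ 0 ^ p ^ a + x 1 * τ 1 ^ p ^ a = V x ^ p ^ a := by
    intro x
    rw [hV, add_pow_expChar_pow, mul_pow, mul_pow, hc, hc]
    rfl
  refine ⟨V, ![C δ⁻¹ * (C (τ 1 ^ p ^ a) * X - C (c 1) * X ^ p ^ a),
    C δ⁻¹ * (C (c 0) * X ^ p ^ a - C (τ 0 ^ p ^ a) * X)], fun s => ?_, fun x hx i => ?_⟩
  · have h1 : V (fun i => (![C δ⁻¹ * (C (τ 1 ^ p ^ a) * X - C (c 1) * X ^ p ^ a),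
        C δ⁻¹ * (C (c 0) * X ^ p ^ a - C (τ 0 ^ p ^ a) * X)] i).eval s) = s := by
      rw [hV]
      simp only [Matrix.cons_val_zero, Matrix.cons_val_one, eval_mul, eval_C, eval_sub, eval_X,
        eval_pow]
      have : s = δ⁻¹ * (δ * s) := by rw [inv_mul_cancel_left₀ hδ0]
      rw [hδ] at this ⊢
      linear_combination -this
    refine ⟨?_, h1⟩
    rw [hmem, h1]
    simp only [Matrix.cons_val_zero, Matrix.cons_val_one, eval_mul, eval_C, eval_sub, eval_X,
      eval_pow]
    have : s ^ p ^ a = δ⁻¹ * (δ * s ^ p ^ a) := by rw [inv_mul_cancel_left₀ hδ0]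
    rw [hδ] at this ⊢
    linear_combination -this
  · rw [hmem] at hx
    fin_cases i
    · simp only [Fin.zero_eta, Matrix.cons_val_zero, eval_mul, eval_C, eval_sub, eval_X, eval_pow]
      rw [inv_mul_eq_iff_eq_mul₀ hδ0, ← hx, hV, hδ]
      ring
    · simp only [Fin.mk_one, Matrix.cons_val_one, Matrix.cons_val_zero, eval_mul, eval_C, eval_sub, eval_X, eval_pow]
      rw [inv_mul_eq_iff_eq_mul₀ hδ0, ← hx, hV, hδ]
      ring

namespace NormalForm

variable {L : (Fin 4 → k) →ₗ[k] (Fin 2 → k)} (D : NormalForm (p ^ a) L)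

/-- A fibre over a nondegenerate point is an affine line, parametrised by a polynomial curve `W`,
with a parameter that is a linear form `V` in the coordinate `x`. -/
theorem exists_parametrisation [IsAlgClosed k] {t : ℙ k (Fin 2 → k)}
    (ht : ¬ IsDegenerate (p ^ a) (D.dir t)) :
    ∃ (V : (Fin 2 → k) →ₗ[k] k) (v : Fibre (p ^ a) L t ≃ k) (W : Fin 4 → k[X]),
      (∀ P, v P = V (D.coord P)) ∧
      ∀ s, (fun l => (W l).eval s) = D.e.symm (D.coord (v.symm s), D.dir t) := by
  obtain ⟨V, P, hP, hV⟩ := exists_affine_coordinate ht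
  let v : Fibre (p ^ a) L t ≃ k :=
    { toFun := fun z => V (D.coord z)
      invFun := fun s => D.fibrePoint t _ (hP s).1
      left_inv := fun z => D.coord_injective t
        ((D.coord_fibrePoint t _ _).trans (funext (hV _ (D.coord_eqn z))))
      right_inv := fun s => (congrArg V (D.coord_fibrePoint t _ _)).trans (hP s).2 }
  refine ⟨V, v, fun l => C (D.e.symm (Pi.single 0 1, 0) l) * P 0 +
    C (D.e.symm (Pi.single 1 1, 0) l) * P 1 + C (D.e.symm (0, D.dir t) l), fun _ => rfl,
    fun s => ?_⟩
  have h1 : D.coord (v.symm s) = fun i => (P i).eval s :=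
    D.coord_fibrePoint t _ (hP s).1
  have h2 : ((fun i => (P i).eval s, D.dir t) : (Fin 2 → k) × (Fin 2 → k)) =
      (P 0).eval s • (Pi.single 0 1, 0) + (P 1).eval s • (Pi.single 1 1, 0) + (0, D.dir t) := by
    refine Prod.ext ?_ (by simp)
    funext i
    fin_cases i <;> simp
  rw [h1, h2, map_add, map_add, map_smul, map_smul]
  funext l
  simp only [eval_add, eval_mul, eval_C, Pi.add_apply, Pi.smul_apply, smul_eq_mul]
  ring

theorem isSingularFibre_of_isDegenerate [IsAlgClosed k] (ha : 0 < a) {t : ℙ k (Fin 2 → k)}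
    (ht : IsDegenerate (p ^ a) (D.dir t)) : IsSingularFibre (p ^ a) L t := by
  have hq : 1 < p ^ a := Nat.one_lt_pow ha.ne' (Fact.out : p.Prime).one_lt
  have hq1 : p ^ a - 1 ≠ 0 := by omega
  obtain ⟨n, hn⟩ : ∃ n, p ^ a = n + 1 := ⟨p ^ a - 1, by omega⟩
  have hn0 : n ≠ 0 := by omega
  have hτ0 := D.dir_ne_zero t
  set τ := D.dir t with hτ
  obtain ⟨c, hc⟩ := exists_roots (pow_pos (Fact.out : p.Prime).pos a) τ
  rw [isDegenerate_iff hc] at ht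
  obtain ⟨j, hj⟩ := Function.ne_iff.1 hτ0
  simp only [Pi.zero_apply] at hj
  have hcj : c j ≠ 0 := fun h => hj (by rw [← hc, h, zero_pow (by omega)])
  -- the two sides of the equation of the fibre depend on the same linear form
  obtain ⟨r, hr0, hr⟩ : ∃ r : k, r ≠ 0 ∧ ∀ i, τ i ^ p ^ a = r * c i := by
    refine ⟨τ j ^ p ^ a / c j, div_ne_zero (pow_ne_zero _ hj) hcj, fun i => ?_⟩
    rw [div_mul_eq_mul_div, eq_div_iff hcj]
    fin_cases i <;> fin_cases j <;> simp_all [mul_comm]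
  let A : (Fin 4 → k) →ₗ[k] (Fin 2 → k) :=
    { toFun := fun v => ![c 0 * (D.e v).1 0 + c 1 * (D.e v).1 1, (D.e v).2 j]
      map_add' := fun v w => by
        funext i; fin_cases i
        · simp; ring
        · simp
      map_smul' := fun b v => by
        funext i; fin_cases i
        · simp; ring
        · simp }
  have hA : ∀ x, A (D.e.symm (x, τ)) = ![c 0 * x 0 + c 1 * x 1, τ j] := by
    intro x
    simp [A]
  obtain ⟨G, hG, hGA⟩ := exists_values_eq_linear A
  have ev : ∀ z : Fibre (p ^ a) L t, ∃ b : k, b ≠ 0 ∧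
      MvPolynomial.eval z.pt.rep (G 0) = b * (c 0 * D.coord z 0 + c 1 * D.coord z 1) ∧
      MvPolynomial.eval z.pt.rep (G 1) = b * τ j := by
    intro z
    obtain ⟨b, hb, h⟩ := D.exists_rep_eq_smul z
    have h1 := hGA z.pt.rep
    rw [h, map_smul, hA] at h1
    refine ⟨b, hb, ?_, ?_⟩
    · rw [h]; exact congrFun h1 0
    · rw [h]; exact congrFun h1 1
  have hmem : ∀ x : Fin 2 → k, dot (p ^ a) x τ = dot (p ^ a) τ x ↔
      r * (c 0 * x 0 + c 1 * x 1) = (c 0 * x 0 + c 1 * x 1) ^ p ^ a := by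
    intro x
    rw [add_pow_expChar_pow, mul_pow, mul_pow, hc, hc, dot, dot, hr, hr, mul_add]
    refine Eq.congr (by ring) rfl
  refine ⟨1, n, G 0, G 0 ^ n - MvPolynomial.C (r / τ j ^ n) * G 1 ^ n, hG 0, ?_, fun z => ?_,
    ?_, ?_⟩
  · have h1 := (hG 0).pow n
    have h2 := (MvPolynomial.isHomogeneous_C (Fin 4) (r / τ j ^ n)).mul ((hG 1).pow n)
    rw [one_mul] at h1
    rw [zero_add, one_mul] at h2
    exact h1.sub h2
  · obtain ⟨b, hb, h1, h2⟩ := ev z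
    have h3 := (hmem _).1 (D.coord_eqn z)
    simp only [map_sub, map_mul, map_pow, MvPolynomial.eval_C, h1, h2]
    set u := c 0 * D.coord z 0 + c 1 * D.coord z 1
    by_cases hu : u = 0
    · left; rw [hu, mul_zero]
    · right
      have h4 : u ^ n = r := by
        rw [hn, pow_succ] at h3
        exact (mul_right_cancel₀ hu h3).symm
      rw [mul_pow, mul_pow, h4]
      have := pow_ne_zero n hj
      field_simp
      ring
  · obtain ⟨u, hu⟩ := IsAlgClosed.exists_pow_nat_eq r (Nat.pos_of_ne_zero hn0)
    have hu0 : u ≠ 0 := fun h => hr0 (by rw [← hu, h, zero_pow hn0])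
    obtain ⟨x, hx⟩ : ∃ x : Fin 2 → k, c 0 * x 0 + c 1 * x 1 = u := by
      refine ⟨Pi.single j (u / c j), ?_⟩
      fin_cases j <;> simp_all [mul_div_cancel₀]
    refine ⟨D.fibrePoint t x ((hmem x).2 (by rw [hx, hn, pow_succ, hu])), ?_⟩
    obtain ⟨b, hb, h1, -⟩ := ev (D.fibrePoint t x ((hmem x).2 (by rw [hx, hn, pow_succ, hu])))
    rw [h1, D.coord_fibrePoint, hx]
    exact mul_ne_zero hb hu0
  · have h0 := (hmem 0).2 (by simp [zero_pow (show p ^ a ≠ 0 by omega)])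
    refine ⟨D.fibrePoint t 0 h0, ?_⟩
    obtain ⟨b, hb, h1, h2⟩ := ev (D.fibrePoint t 0 h0)
    simp only [map_sub, map_mul, map_pow, MvPolynomial.eval_C, h1, h2, D.coord_fibrePoint,
      Pi.zero_apply, mul_zero, add_zero, zero_pow hn0, zero_sub, neg_ne_zero]
    exact mul_ne_zero (div_ne_zero hr0 (pow_ne_zero _ hj)) (pow_ne_zero _ (mul_ne_zero hb hj))

theorem isSingularFibre_iff [IsAlgClosed k] (ha : 0 < a) (t : ℙ k (Fin 2 → k)) :
    IsSingularFibre (p ^ a) L t ↔ IsDegenerate (p ^ a) (D.dir t) := by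
  refine ⟨fun h => ?_, D.isSingularFibre_of_isDegenerate ha⟩
  by_contra ht
  obtain ⟨V, v, W, -, hW⟩ := D.exists_parametrisation ht
  obtain ⟨d₁, d₂, G₁, G₂, hG₁, hG₂, hall, ⟨x₁, hx₁⟩, ⟨x₂, hx₂⟩⟩ := h
  have key : ∀ (d : ℕ) (G : MvPolynomial (Fin 4) k), G.IsHomogeneous d → ∃ Q : k[X],
      ∀ x : Fibre (p ^ a) L t, MvPolynomial.eval x.pt.rep G = 0 ↔ Q.eval (v x) = 0 := by
    intro d G hG
    obtain ⟨Q, hQ⟩ := exists_polynomial_eval_curve W G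
    refine ⟨Q, fun x => ?_⟩
    obtain ⟨b, hb, h⟩ := D.exists_rep_eq_smul x
    have h1 := congrFun (values_smul (G := fun _ : Unit => G) (fun _ => hG) b
      (D.e.symm (D.coord x, D.dir t))) ()
    simp only [values, Pi.smul_apply, smul_eq_mul] at h1
    rw [h, h1, mul_eq_zero, or_iff_right (pow_ne_zero _ hb), hQ, hW, v.symm_apply_apply]
  obtain ⟨Q₁, hQ₁⟩ := key d₁ G₁ hG₁
  obtain ⟨Q₂, hQ₂⟩ := key d₂ G₂ hG₂
  have hQ : Q₁ * Q₂ = 0 := Polynomial.funext fun s => by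
    have h1 := hall (v.symm s)
    rw [hQ₁, hQ₂, v.apply_symm_apply] at h1
    rw [eval_mul, eval_zero, mul_eq_zero]
    exact h1
  rcases mul_eq_zero.1 hQ with h | h
  · exact hx₁ ((hQ₁ x₁).2 (by rw [h, eval_zero]))
  · exact hx₂ ((hQ₂ x₂).2 (by rw [h, eval_zero]))

theorem ncard_isSingularFibre [IsAlgClosed k] (D : NormalForm (p ^ a) L) (ha : 0 < a) :
    {t | IsSingularFibre (p ^ a) L t}.ncard = (p ^ a) ^ 2 + 1 := by
  have hq0 : p ^ a ≠ 0 := pow_ne_zero _ (Fact.out : p.Prime).ne_zero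
  have hm : ∀ {τ : Fin 2 → k}, τ ≠ 0 → D.m τ ≠ 0 := fun h => (LinearEquiv.map_ne_zero_iff _).2 h
  have hs : ∀ s : k, D.m ![s, 1] ≠ 0 := fun s => hm fun h => one_ne_zero (congrFun h 1)
  have hi : D.m ![1, 0] ≠ 0 := hm fun h => one_ne_zero (congrFun h 0)
  have hdeg : ∀ {τ : Fin 2 → k} (h : D.m τ ≠ 0),
      IsDegenerate (p ^ a) (D.dir (Projectivization.mk k _ h)) ↔ IsDegenerate (p ^ a) τ := by
    intro τ h
    obtain ⟨c, hc, h1⟩ := D.exists_dir_mk_eq_smul h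
    rw [h1, isDegenerate_smul_iff _ hc]
  have hset : {t | IsSingularFibre (p ^ a) L t} = insert (Projectivization.mk k _ hi)
      ((fun s => Projectivization.mk k _ (hs s)) '' {s : k | s ^ (p ^ a) ^ 2 = s}) := by
    ext t
    rw [Set.mem_ofPred_eq, D.isSingularFibre_iff ha, Set.mem_insert_iff]
    constructor
    · intro h
      by_cases h1 : D.dir t 1 = 0
      · left
        refine D.mk_eq_of_dir hi (c := D.dir t 0) ?_
        funext i
        fin_cases i <;> simp [h1]
      · right
        have ht := D.mk_eq_of_dir (hs (D.dir t 0 / D.dir t 1)) (c := D.dir t 1) (t := t) (by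
          funext i
          fin_cases i <;> simp [mul_div_cancel₀, h1])
        refine ⟨_, ?_, ht.symm⟩
        rw [ht, hdeg] at h
        simpa [IsDegenerate] using h
    · rintro (rfl | ⟨s, hs', rfl⟩)
      · rw [hdeg]
        simp [IsDegenerate, zero_pow (pow_ne_zero 2 hq0)]
      · rw [hdeg]
        simpa [IsDegenerate] using hs'
  have hinj : Function.Injective fun s => Projectivization.mk k _ (hs s) := by
    intro s s' h
    obtain ⟨c, hc, h1⟩ := exists_eq_smul_of_mk_eq_mk h
    rw [← map_smul] at h1
    have h2 := D.m.injective h1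
    have h3 := congrFun h2 0
    have h4 := congrFun h2 1
    simp at h3 h4
    rw [h3, ← h4, one_mul]
  have hcard := ncard_pow_eq_self (k := k) p (n := a * 2) (by omega)
  rw [pow_mul] at hcard
  have hfin : {s : k | s ^ (p ^ a) ^ 2 = s}.Finite := by
    refine Set.finite_of_ncard_ne_zero ?_
    rw [hcard]
    exact pow_ne_zero 2 hq0
  rw [hset, Set.ncard_insert_of_notMem _ (hfin.image _), Set.ncard_image_of_injective _ hinj, hcard]
  rintro ⟨s, -, h⟩
  obtain ⟨c, hc, h1⟩ := exists_eq_smul_of_mk_eq_mk h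
  rw [← map_smul] at h1
  have h4 := congrFun (D.m.injective h1) 1
  simp at h4

end NormalForm

end CharP

end SingularFibres

/-! ### Arbitrary group laws on the nonsingular fibres -/

section GroupLaws

open Polynomial

variable {k : Type*} [Field k]

namespace NormalForm

/-- The parameter of a regularly moving point of a nonsingular fibre, expressed as a polynomial. -/
theorem exists_polynomial_param [IsAlgClosed k] {q : ℕ}
    {L : (Fin 4 → k) →ₗ[k] (Fin 2 → k)} (D : NormalForm q L) {t : ℙ k (Fin 2 → k)} (V : (Fin 2 → k) →ₗ[k] k)
    (φ : k → Fibre (q) L t)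
    (hφ : IsRegular affinePoint fun s => (φ s).pt) :
    ∃ P : k[X], ∀ s, V (D.coord (φ s)) = P.eval s := by
  obtain ⟨j, hj⟩ := Function.ne_iff.1 (D.dir_ne_zero t)
  simp only [Pi.zero_apply] at hj
  obtain ⟨P, hP⟩ := exists_polynomial_of_isRegular hφ
    (fun s => D.e.symm (D.coord (φ s), D.dir t)) (fun s => D.symm_ne_zero _ (D.dir_ne_zero t))
    (fun s => D.pt_eq (φ s)) (V ∘ₗ LinearMap.fst k _ _ ∘ₗ D.e.toLinearMap)
    (LinearMap.proj j ∘ₗ LinearMap.snd k _ _ ∘ₗ D.e.toLinearMap) (fun s => by simpa using hj)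
  refine ⟨P * C (D.dir t j), fun s => ?_⟩
  have := hP s
  simp only [LinearMap.comp_apply, LinearEquiv.coe_coe, LinearEquiv.apply_symm_apply,
    LinearMap.fst_apply, LinearMap.snd_apply, LinearMap.proj_apply] at this
  rw [this, eval_mul, eval_C]

theorem param_mul [IsAlgClosed k] {q : ℕ} {L : (Fin 4 → k) →ₗ[k] (Fin 2 → k)}
    (D : NormalForm q L) [PencilGroup q L] {t : ℙ k (Fin 2 → k)}
    {V : (Fin 2 → k) →ₗ[k] k} {v : Fibre q L t ≃ k} {W : Fin 4 → k[X]}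
    (hv : ∀ P, v P = V (D.coord P))
    (hW : ∀ s, (fun l => (W l).eval s) = D.e.symm (D.coord (v.symm s), D.dir t))
    (P P' : Fibre q L t) : v (P * P') = v P + v P' - v 1 := by
  have hW0 : ∀ s, (fun l => (W l).eval s) ≠ 0 := fun s => by
    rw [hW]; exact D.symm_ne_zero _ (D.dir_ne_zero t)
  have hreg : IsRegular affinePoint fun s => (v.symm s).pt := by
    have h : (fun s => (v.symm s).pt) = fun s => Projectivization.mk k _ (hW0 s) := by
      funext s
      rw [D.pt_eq]
      simp only [hW]
    rw [h]
    exact isRegular_of_polynomial W hW0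
  refine coord_mul_of_polynomial_translations v (fun g => ?_) (fun h => ?_) P P'
  · obtain ⟨Q, hQ⟩ := D.exists_polynomial_param V (fun s => g * v.symm s)
      ((PencilGroup.regular_mul (L := L)).comp (fun s => ⟨t, g, v.symm s⟩)
        (isRegular_const affinePoint g.pt) hreg)
    exact ⟨Q, fun h => by rw [hv, ← hQ, v.symm_apply_apply]⟩
  · obtain ⟨Q, hQ⟩ := D.exists_polynomial_param V (fun s => v.symm s * h)
      ((PencilGroup.regular_mul (L := L)).comp (fun s => ⟨t, v.symm s, h⟩)
        hreg (isRegular_const affinePoint h.pt))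
    exact ⟨Q, fun g => by rw [hv, ← hQ, v.symm_apply_apply]⟩

variable {p : ℕ} [Fact p.Prime] [CharP k p] {a : ℕ} {L : (Fin 4 → k) →ₗ[k] (Fin 2 → k)}
  (D : NormalForm (p ^ a) L)

/-- On a nonsingular fibre every group law of a group scheme structure is the addition of the
coordinate `x`, up to the choice of the neutral element. -/
theorem coord_mul_of_not_isDegenerate [IsAlgClosed k] [PencilGroup (p ^ a) L]
    {t : ℙ k (Fin 2 → k)} (ht : ¬ IsDegenerate (p ^ a) (D.dir t)) (P P' : Fibre (p ^ a) L t) :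
    D.coord (P * P') = D.coord P + D.coord P' - D.coord (1 : Fibre (p ^ a) L t) := by
  obtain ⟨V, v, W, hv, hW⟩ := D.exists_parametrisation ht
  have hmem : dot (p ^ a) (D.coord P + D.coord P' - D.coord (1 : Fibre (p ^ a) L t)) (D.dir t) =
      dot (p ^ a) (D.dir t) (D.coord P + D.coord P' - D.coord (1 : Fibre (p ^ a) L t)) :=
    sub_mem (S := AddSubgroup (Fin 2 → k)) (H := solutions p a (D.dir t))
      (add_mem (D.coord_eqn P) (D.coord_eqn P')) (D.coord_eqn 1)
  have h : P * P' = D.fibrePoint t _ hmem := by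
    apply v.injective
    rw [D.param_mul hv hW, hv, hv, hv, hv, D.coord_fibrePoint, map_sub, map_add]
  rw [h, D.coord_fibrePoint]

theorem isAdditiveFibre_of_not_isDegenerate [IsAlgClosed k] [PencilGroup (p ^ a) L]
    {t : ℙ k (Fin 2 → k)} (ht : ¬ IsDegenerate (p ^ a) (D.dir t)) :
    IsAdditiveFibre (p ^ a) L t := by
  obtain ⟨V, v, W, hv, hW⟩ := D.exists_parametrisation ht
  obtain ⟨j, hj⟩ := Function.ne_iff.1 (D.dir_ne_zero t)
  simp only [Pi.zero_apply] at hj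
  let e : Multiplicative k ≃* Fibre (p ^ a) L t :=
    { toFun := fun s => v.symm (s.toAdd + v 1)
      invFun := fun z => Multiplicative.ofAdd (v z - v 1)
      left_inv := fun s => by simp
      right_inv := fun z => by simp
      map_mul' := fun s s' => by
        apply v.injective
        rw [D.param_mul hv hW]
        simp only [Equiv.apply_symm_apply, toAdd_mul]
        ring }
  refine ⟨e, ?_, ?_⟩
  · have hW' : ∀ s, (fun l => ((W l).comp (X + C (v 1))).eval s) =
        D.e.symm (D.coord (e (Multiplicative.ofAdd s)), D.dir t) := by
      intro s
      rw [show e (Multiplicative.ofAdd s) = v.symm (s + v 1) from rfl, ← hW]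
      funext l
      simp [eval_comp]
    have hW0 : ∀ s, (fun l => ((W l).comp (X + C (v 1))).eval s) ≠ 0 := fun s => by
      rw [hW']; exact D.symm_ne_zero _ (D.dir_ne_zero t)
    have h : (fun s => (e (Multiplicative.ofAdd s)).pt) =
        fun s => Projectivization.mk k _ (hW0 s) := by
      funext s
      rw [D.pt_eq]
      simp only [hW']
    rw [h]
    exact isRegular_of_polynomial _ hW0
  · let A : (Fin 4 → k) →ₗ[k] (Fin 2 → k) :=
      { toFun := fun u => ![V (D.e u).1 * D.dir t j - v 1 * (D.e u).2 j, (D.e u).2 j]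
        map_add' := fun u w => by
          funext i; fin_cases i
          · simp; ring
          · simp
        map_smul' := fun b u => by
          funext i; fin_cases i
          · simp; ring
          · simp }
    have key : ∀ z : Fibre (p ^ a) L t, ∃ b : k, b ≠ 0 ∧ A z.pt.rep = b • ![v z - v 1, 1] := by
      intro z
      obtain ⟨b, hb, h⟩ := D.exists_rep_eq_smul z
      refine ⟨b * D.dir t j, mul_ne_zero hb hj, ?_⟩
      rw [h, map_smul, mul_smul, hv z]
      congr 1
      funext i
      fin_cases i
      · simp [A]; ring
      · simp [A]
    refine isRegular_of_linear A (fun z => ?_) (fun z => ?_)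
    · obtain ⟨b, hb, h⟩ := key z
      rw [h]
      exact smul_ne_zero hb fun h => one_ne_zero (congrFun h 1)
    · obtain ⟨b, hb, h⟩ := key z
      exact (mk_eq_mk_of_eq_smul _ _ h).symm

end NormalForm

end GroupLaws

/-! ### Hermitian matrices -/

section Hermitian

open Matrix

variable {k : Type*} [Field k] (p : ℕ) [Fact p.Prime] [CharP k p] (a : ℕ)

variable (k) in
/-- The Hermitian `2 × 2` matrices over the field with `q²` elements, as the matrices over `k` whose
transpose is their `q`-Frobenius transform. -/
def hermitian : AddSubgroup (Matrix (Fin 2) (Fin 2) k) where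
  carrier := {M | ∀ i j, M i j ^ p ^ a = M j i}
  zero_mem' := fun i j => zero_pow (pow_ne_zero _ (Fact.out : p.Prime).ne_zero)
  add_mem' {M N} hM hN := fun i j => by
    rw [Matrix.add_apply, Matrix.add_apply, add_pow_expChar_pow, hM, hN]
  neg_mem' {M} hM := fun i j => by
    have h := sub_pow_expChar_pow (0 : k) (M i j) a (p := p)
    rw [zero_pow (pow_ne_zero _ (Fact.out : p.Prime).ne_zero), zero_sub, zero_sub, hM] at h
    exact h

theorem mem_hermitian_iff {M : Matrix (Fin 2) (Fin 2) k} :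
    M ∈ hermitian k p a ↔ ∀ i j, M i j ^ p ^ a = M j i := Iff.rfl

theorem dot_mulVec_of_mem_hermitian {M : Matrix (Fin 2) (Fin 2) k} (hM : M ∈ hermitian k p a)
    (τ : Fin 2 → k) : dot (p ^ a) (M *ᵥ τ) τ = dot (p ^ a) τ (M *ᵥ τ) := by
  rw [mem_hermitian_iff] at hM
  simp only [dot, mulVec, dotProduct, Fin.sum_univ_two, add_pow_expChar_pow, mul_pow, hM]
  ring

theorem mem_hermitian_of_dot_mulVec [Infinite k] (hq : 1 < p ^ a) {M : Matrix (Fin 2) (Fin 2) k}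
    (hM : ∀ τ, τ ≠ 0 → dot (p ^ a) (M *ᵥ τ) τ = dot (p ^ a) τ (M *ᵥ τ)) :
    M ∈ hermitian k p a := by
  have h0 : (0 : k) ^ p ^ a = 0 := zero_pow (by omega)
  have h10 := hM ![1, 0] fun h => one_ne_zero (congrFun h 0)
  have h01 := hM ![0, 1] fun h => one_ne_zero (congrFun h 1)
  simp only [dot, mulVec, dotProduct, Fin.sum_univ_two, Matrix.cons_val_zero, Matrix.cons_val_one, h0, one_pow, mul_one, mul_zero, add_zero, zero_add,
    zero_mul, one_mul] at h10 h01
  have hs := eq_zero_of_add_pow_eq_zero hq (A := M 1 0 - M 0 1 ^ p ^ a)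
    (B := M 0 1 - M 1 0 ^ p ^ a) fun s => by
      have h := hM ![s, 1] fun h => one_ne_zero (congrFun h 1)
      simp only [dot, mulVec, dotProduct, Fin.sum_univ_two, add_pow_expChar_pow, mul_pow,
        Matrix.cons_val_zero, Matrix.cons_val_one, one_pow, mul_one, one_mul] at h
      linear_combination h - s * s ^ p ^ a * h10 - h01
  intro i j
  fin_cases i <;> fin_cases j
  · exact h10.symm
  · exact (sub_eq_zero.1 hs.1).symm
  · exact (sub_eq_zero.1 hs.2).symm
  · exact h01.symm

theorem card_hermitian [IsAlgClosed k] (ha : a ≠ 0) :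
    Nat.card (hermitian k p a) = p ^ (4 * a) := by
  have e : hermitian k p a ≃ {x : k | x ^ p ^ a = x} × {x : k | x ^ p ^ a = x} ×
      {x : k | x ^ p ^ (2 * a) = x} :=
    { toFun := fun M => ⟨⟨M.1 0 0, M.2 0 0⟩, ⟨M.1 1 1, M.2 1 1⟩, ⟨M.1 0 1, by
        rw [Set.mem_ofPred_eq, two_mul, pow_add, pow_mul, M.2, M.2]⟩⟩
      invFun := fun z => ⟨!![z.1.1, z.2.2.1; z.2.2.1 ^ p ^ a, z.2.1.1], fun i j => by
        have h1 : z.1.1 ^ p ^ a = z.1.1 := z.1.2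
        have h2 : z.2.1.1 ^ p ^ a = z.2.1.1 := z.2.1.2
        have h3 : (z.2.2.1 ^ p ^ a) ^ p ^ a = z.2.2.1 := by
          rw [← pow_mul, ← pow_add, ← two_mul]; exact z.2.2.2
        fin_cases i <;> fin_cases j
        exacts [h1, rfl, h3, h2]⟩
      left_inv := fun M => by
        refine Subtype.ext (Matrix.ext fun i j => ?_)
        fin_cases i <;> fin_cases j
        exacts [rfl, rfl, M.2 0 1, rfl]
      right_inv := fun z => rfl }
  rw [Nat.card_congr e, Nat.card_prod, Nat.card_prod, Nat.card_coe_set_eq, Nat.card_coe_set_eq,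
    ncard_pow_eq_self p ha, ncard_pow_eq_self p (by omega), ← pow_add, ← pow_add]
  congr 1
  omega

variable {p a}

theorem nonempty_addEquiv_of_card {G : Type*} [AddCommGroup G] [Module (ZMod p) G] {n : ℕ}
    (hcard : Nat.card G = p ^ n) : Nonempty (G ≃+ (Fin n → ZMod p)) := by
  have : Finite G := Nat.finite_of_card_ne_zero (by
    rw [hcard]; exact pow_ne_zero _ (Fact.out : p.Prime).ne_zero)
  have : Module.Finite (ZMod p) G := Module.Finite.of_finite
  have h := Module.natCard_eq_pow_finrank (K := ZMod p) (V := G)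
  rw [hcard, Nat.card_zmod] at h
  have h2 : Module.finrank (ZMod p) G = n := (Nat.pow_right_injective
    (Fact.out : p.Prime).two_le h).symm
  exact ⟨(LinearEquiv.ofFinrankEq (R := ZMod p) G (Fin n → ZMod p) (by simp [h2])).toAddEquiv⟩

variable (k p a) in
theorem nonempty_hermitian_addEquiv [IsAlgClosed k] (ha : a ≠ 0) :
    Nonempty (hermitian k p a ≃+ (Fin (4 * a) → ZMod p)) := by
  let _ : Module (ZMod p) (hermitian k p a) :=
    AddCommGroup.zmodModule fun M => Subtype.ext (Matrix.ext fun i j => by simp)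
  exact nonempty_addEquiv_of_card (card_hermitian p a ha)

end Hermitian

/-! ### Sections -/

section Sections

open Matrix Polynomial

variable {k : Type*} [Field k]

theorem swap_apply (τ : Fin 2 → k) :
    LinearEquiv.funCongrLeft k k (Equiv.swap (0 : Fin 2) 1) τ = ![τ 1, τ 0] := by
  funext i
  fin_cases i <;> simp [LinearEquiv.funCongrLeft_apply, LinearMap.funLeft_apply]

namespace NormalForm

/-- On the affine part of the projective line given by a choice of coordinates `N`, a section is
given by polynomials. -/
theorem exists_chart_polynomial [IsAlgClosed k] {q : ℕ} {L : (Fin 4 → k) →ₗ[k] (Fin 2 → k)}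
    (D : NormalForm q L) {σ : ∀ t, Fibre q L t} (hσ : IsSection q L σ)
    (N : (Fin 2 → k) ≃ₗ[k] (Fin 2 → k)) (i : Fin 2) :
    ∃ P : k[X], ∀ t τ, D.dir t = N τ → τ 1 ≠ 0 →
      D.coord (σ t) i = τ 1 * P.eval (τ 0 / τ 1) := by
  have hne : ∀ s : k, D.m (N ![s, 1]) ≠ 0 := fun s => by
    rw [LinearEquiv.map_ne_zero_iff, LinearEquiv.map_ne_zero_iff]
    exact fun h => one_ne_zero (congrFun h 1)
  have hchart : IsRegular affinePoint fun s => Projectivization.mk k _ (hne s) := by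
    have key : ∀ s : k, ∃ b : k, b ≠ 0 ∧ (D.m.toLinearMap ∘ₗ N.toLinearMap) (affinePoint s).rep =
        b • D.m (N ![s, 1]) := by
      intro s
      obtain ⟨b, hb, h⟩ := exists_rep_affinePoint s
      exact ⟨b, hb, by rw [h, map_smul]; rfl⟩
    refine isRegular_of_linear (D.m.toLinearMap ∘ₗ N.toLinearMap) (fun s => ?_) (fun s => ?_)
    · obtain ⟨b, hb, h⟩ := key s
      rw [h]
      exact smul_ne_zero hb (hne s)
    · obtain ⟨b, hb, h⟩ := key s
      exact (mk_eq_mk_of_eq_smul _ _ h).symm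
  have hcomp := (IsRegular.onProduct hσ).comp (fun s => Projectivization.mk k _ (hne s))
    hchart hchart
  have hdir : ∀ s, ∃ b : k, b ≠ 0 ∧ D.dir (Projectivization.mk k _ (hne s)) = b • N ![s, 1] :=
    fun s => D.exists_dir_mk_eq_smul (hne s)
  obtain ⟨P, hP⟩ := exists_polynomial_of_isRegular hcomp
    (fun s => D.e.symm (D.coord (σ (Projectivization.mk k _ (hne s))),
      D.dir (Projectivization.mk k _ (hne s))))
    (fun s => D.symm_ne_zero _ (D.dir_ne_zero _)) (fun s => D.pt_eq _)
    (LinearMap.proj i ∘ₗ LinearMap.fst k _ _ ∘ₗ D.e.toLinearMap)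
    (LinearMap.proj 1 ∘ₗ N.symm.toLinearMap ∘ₗ LinearMap.snd k _ _ ∘ₗ D.e.toLinearMap)
    (fun s => by
      obtain ⟨b, hb, h⟩ := hdir s
      simpa [h] using hb)
  refine ⟨P, fun t τ ht hτ => ?_⟩
  have hτ' : τ = τ 1 • ![τ 0 / τ 1, 1] := by
    funext l
    fin_cases l <;> simp [mul_div_cancel₀, hτ]
  have h1 := D.mk_eq_of_dir (hne (τ 0 / τ 1)) (c := τ 1) (t := t) (by
    rw [ht, ← map_smul, ← hτ'])
  have h2 := hP (τ 0 / τ 1)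
  rw [← h1] at h2
  simp only [LinearMap.comp_apply, LinearEquiv.coe_coe, LinearEquiv.apply_symm_apply,
    LinearMap.fst_apply, LinearMap.snd_apply, LinearMap.proj_apply, ht,
    LinearEquiv.symm_apply_apply] at h2
  rw [h2, mul_comm]

theorem exists_matrix_of_isSection [IsAlgClosed k] {q : ℕ} {L : (Fin 4 → k) →ₗ[k] (Fin 2 → k)}
    (D : NormalForm q L) {σ : ∀ t, Fibre q L t} (hσ : IsSection q L σ) :
    ∃ M : Matrix (Fin 2) (Fin 2) k, ∀ t, D.coord (σ t) = M *ᵥ D.dir t := by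
  have h : ∀ i, ∃ b c : k, ∀ t, D.coord (σ t) i = b * D.dir t 0 + c * D.dir t 1 := by
    intro i
    obtain ⟨P, hP⟩ := D.exists_chart_polynomial hσ (LinearEquiv.refl k _) i
    obtain ⟨P', hP'⟩ := D.exists_chart_polynomial hσ
      (LinearEquiv.funCongrLeft k k (Equiv.swap (0 : Fin 2) 1)) i
    replace hP : ∀ t, D.dir t 1 ≠ 0 →
        D.coord (σ t) i = D.dir t 1 * P.eval (D.dir t 0 / D.dir t 1) := fun t => hP t _ rfl
    replace hP' : ∀ t, D.dir t 0 ≠ 0 →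
        D.coord (σ t) i = D.dir t 0 * P'.eval (D.dir t 1 / D.dir t 0) := fun t ht =>
      hP' t ![D.dir t 1, D.dir t 0] (by
        rw [swap_apply]; funext l; fin_cases l <;> rfl) ht
    obtain ⟨b, c, hb, hc⟩ := exists_linear_of_eval_eq (P := P) (P' := P') fun s hs => by
      have hne : D.m ![s, 1] ≠ 0 :=
        (LinearEquiv.map_ne_zero_iff _).2 fun h => one_ne_zero (congrFun h 1)
      obtain ⟨r, hr, hdir⟩ := D.exists_dir_mk_eq_smul hne
      have h0 : D.dir (Projectivization.mk k _ hne) 0 = r * s := by rw [hdir]; simp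
      have h1 : D.dir (Projectivization.mk k _ hne) 1 = r := by rw [hdir]; simp
      have h2 := (hP _ (by rw [h1]; exact hr)).symm.trans
        (hP' _ (by rw [h0]; exact mul_ne_zero hr hs))
      rw [h0, h1, mul_div_cancel_left₀ _ hr, div_mul_cancel_left₀ hr, mul_assoc] at h2
      exact mul_left_cancel₀ hr h2
    refine ⟨b, c, fun t => ?_⟩
    by_cases h1 : D.dir t 1 = 0
    · have h0 : D.dir t 0 ≠ 0 := fun h0 => D.dir_ne_zero t (by
        funext l; fin_cases l
        exacts [h0, h1])
      rw [hP' t h0, hc]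
      field_simp
    · rw [hP t h1, hb]
      field_simp
  choose b c hbc using h
  refine ⟨Matrix.of fun i => ![b i, c i], fun t => ?_⟩
  funext i
  rw [hbc]
  simp [mulVec, dotProduct, Fin.sum_univ_two]

variable {p : ℕ} [Fact p.Prime] [CharP k p] {a : ℕ} {L : (Fin 4 → k) →ₗ[k] (Fin 2 → k)}
  (D : NormalForm (p ^ a) L)

theorem mem_hermitian_of_coord_eq [Infinite k] (ha : 0 < a) {σ : ∀ t, Fibre (p ^ a) L t}
    {M : Matrix (Fin 2) (Fin 2) k} (hM : ∀ t, D.coord (σ t) = M *ᵥ D.dir t) :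
    M ∈ hermitian k p a := by
  refine mem_hermitian_of_dot_mulVec p a (Nat.one_lt_pow ha.ne' (Fact.out : p.Prime).one_lt)
    fun τ hτ => ?_
  obtain ⟨c, hc, h⟩ := D.exists_dir_mk_eq_smul ((LinearEquiv.map_ne_zero_iff D.m).2 hτ)
  have h1 := D.coord_eqn (σ (Projectivization.mk k _ ((LinearEquiv.map_ne_zero_iff D.m).2 hτ)))
  rw [hM, h, Matrix.mulVec_smul, dot_smul_left, dot_smul_right, dot_smul_left, dot_smul_right] at h1
  exact mul_left_cancel₀ (pow_ne_zero _ hc) (mul_left_cancel₀ hc h1)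

/-- The section `x = M y` attached to a Hermitian matrix. -/
noncomputable def sectionOf (M : hermitian k p a) (t : ℙ k (Fin 2 → k)) : Fibre (p ^ a) L t :=
  D.fibrePoint t (M.1 *ᵥ D.dir t) (dot_mulVec_of_mem_hermitian p a M.2 _)

theorem coord_sectionOf (M : hermitian k p a) (t : ℙ k (Fin 2 → k)) :
    D.coord (D.sectionOf M t) = M.1 *ᵥ D.dir t := D.coord_fibrePoint t _ _

theorem isSection_sectionOf (M : hermitian k p a) : IsSection (p ^ a) L (D.sectionOf M) := by
  let A : (Fin 2 → k) →ₗ[k] (Fin 4 → k) := D.e.symm.toLinearMap ∘ₗ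
    LinearMap.prod (Matrix.mulVecLin M.1) LinearMap.id ∘ₗ D.m.symm.toLinearMap
  have key : ∀ t : ℙ k (Fin 2 → k), A t.rep = D.e.symm (M.1 *ᵥ D.dir t, D.dir t) := fun t => rfl
  refine isRegular_of_linear A (fun t => ?_) fun t => ?_
  · rw [key]; exact D.symm_ne_zero _ (D.dir_ne_zero _)
  · rw [D.pt_eq]
    refine mk_eq_mk_of_eq_smul (a := 1) _ _ ?_
    rw [one_smul, key, D.coord_sectionOf]

theorem exists_eq_sectionOf [IsAlgClosed k] (ha : 0 < a) {σ : ∀ t, Fibre (p ^ a) L t}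
    (hσ : IsSection (p ^ a) L σ) : ∃ M, σ = D.sectionOf M := by
  obtain ⟨M, hM⟩ := D.exists_matrix_of_isSection hσ
  refine ⟨⟨M, D.mem_hermitian_of_coord_eq ha hM⟩, ?_⟩
  funext t
  apply D.coord_injective t
  rw [hM, D.coord_sectionOf]

theorem matrix_eq_of_mulVec_dir_eq [Infinite k] (ha : 0 < a) {M M' : Matrix (Fin 2) (Fin 2) k}
    (h : ∀ t, ¬ IsDegenerate (p ^ a) (D.dir t) → M *ᵥ D.dir t = M' *ᵥ D.dir t) : M = M' := by
  have hq : 1 < (p ^ a) ^ 2 :=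
    Nat.one_lt_pow two_ne_zero (Nat.one_lt_pow ha.ne' (Fact.out : p.Prime).one_lt)
  obtain ⟨s, hs⟩ := exists_pow_ne_self (k := k) hq
  have key : ∀ s : k, s ^ (p ^ a) ^ 2 ≠ s → M *ᵥ ![s, 1] = M' *ᵥ ![s, 1] := by
    intro s hs
    have hne : D.m ![s, 1] ≠ 0 :=
      (LinearEquiv.map_ne_zero_iff _).2 fun h => one_ne_zero (congrFun h 1)
    obtain ⟨c, hc, hdir⟩ := D.exists_dir_mk_eq_smul hne
    have h1 := h (Projectivization.mk k _ hne) (by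
      rw [hdir, isDegenerate_smul_iff _ hc]
      simpa [IsDegenerate] using hs)
    rw [hdir, Matrix.mulVec_smul, Matrix.mulVec_smul] at h1
    exact smul_right_injective _ hc h1
  have hs' : (s + 1) ^ (p ^ a) ^ 2 ≠ s + 1 := by
    rw [← pow_mul, add_pow_expChar_pow, one_pow, pow_mul]
    exact fun h => hs (add_right_cancel h)
  have h1 := key s hs
  have h2 := key (s + 1) hs'
  ext i j
  have h3 := congrFun h1 i
  have h4 := congrFun h2 i
  simp only [mulVec, dotProduct, Fin.sum_univ_two, Matrix.cons_val_zero, Matrix.cons_val_one,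
    mul_one] at h3 h4
  have h5 : M i 0 = M' i 0 := by linear_combination h4 - h3
  fin_cases j
  · exact h5
  · change M i 1 = M' i 1
    rw [h5] at h3
    exact add_left_cancel h3

theorem sectionOf_injective [Infinite k] (ha : 0 < a) : Function.Injective D.sectionOf := by
  intro M M' h
  refine Subtype.ext (D.matrix_eq_of_mulVec_dir_eq ha fun t _ => ?_)
  rw [← D.coord_sectionOf, ← D.coord_sectionOf, h]

/-- The sections form a group isomorphic to that of the Hermitian matrices, for every group scheme
structure: the group law is the addition up to translation by the unit section on the
nonsingular fibres, and a section is determined by its values there. -/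
theorem nonempty_sections_mulEquiv [IsAlgClosed k] (D : NormalForm (p ^ a) L) (ha : 0 < a)
    [PencilGroup (p ^ a) L] :
    Nonempty (sections (p ^ a) L ≃* Multiplicative (hermitian k p a)) := by
  choose mat hmat using fun σ : sections (p ^ a) L => D.exists_eq_sectionOf ha σ.2
  have hcoord : ∀ (σ : sections (p ^ a) L) t, D.coord (σ.1 t) = (mat σ).1 *ᵥ D.dir t := by
    intro σ t
    conv_lhs => rw [hmat σ]
    exact D.coord_sectionOf _ t
  have hmul : ∀ σ σ', mat (σ * σ') = mat σ + mat σ' - mat 1 := by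
    intro σ σ'
    refine Subtype.ext (D.matrix_eq_of_mulVec_dir_eq ha fun t ht => ?_)
    rw [← hcoord]
    change D.coord (σ.1 t * σ'.1 t) = ((mat σ).1 + (mat σ').1 - (mat 1).1) *ᵥ _
    rw [D.coord_mul_of_not_isDegenerate ht, Matrix.sub_mulVec, Matrix.add_mulVec, ← hcoord,
      ← hcoord, ← hcoord]
    rfl
  let φ : sections (p ^ a) L →* Multiplicative (hermitian k p a) :=
    MonoidHom.mk' (fun σ => Multiplicative.ofAdd (mat σ - mat 1)) fun σ σ' => by
      rw [← ofAdd_add, hmul]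
      congr 1
      abel
  refine ⟨MulEquiv.ofBijective φ ⟨fun σ σ' h => ?_, fun M => ?_⟩⟩
  · have h1 : mat σ = mat σ' := sub_left_injective (Multiplicative.ofAdd.injective h)
    exact Subtype.ext (by rw [hmat σ, hmat σ', h1])
  · let σ : sections (p ^ a) L := ⟨D.sectionOf (M.toAdd + mat 1), D.isSection_sectionOf _⟩
    have h1 : mat σ = M.toAdd + mat 1 := D.sectionOf_injective ha (hmat σ).symm
    refine ⟨σ, ?_⟩
    change Multiplicative.ofAdd (mat σ - mat 1) = M
    rw [h1, add_sub_cancel_right, ofAdd_toAdd]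

end NormalForm

end Sections

/-! ### Lines on the surface -/

section Lines

open Matrix

variable {k : Type*} [Field k]

/-- A section is determined by its image. -/
theorem injective_range_section {q : ℕ} {L : (Fin 4 → k) →ₗ[k] (Fin 2 → k)} :
    Function.Injective fun σ : ∀ t, Fibre q L t => Set.range fun t => (σ t).pt := by
  intro σ σ' h
  funext t
  have h1 : (σ t).pt ∈ Set.range fun t => (σ' t).pt := h.subset ⟨t, rfl⟩
  obtain ⟨t', ht'⟩ := h1
  have h2 : (σ' t').1 = (σ t).1 := Subtype.ext ht'
  obtain rfl : t' = t := by
    rw [← (σ' t').2, ← (σ t).2, h2]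
  exact (Subtype.ext h2).symm

namespace NormalForm

section

variable {q : ℕ} {L : (Fin 4 → k) →ₗ[k] (Fin 2 → k)} (D : NormalForm q L)

/-- The line `x = M y`. -/
def lineOf (M : Matrix (Fin 2) (Fin 2) k) : Submodule k (Fin 4 → k) :=
  LinearMap.range (D.e.symm.toLinearMap ∘ₗ LinearMap.prod (Matrix.mulVecLin M) LinearMap.id)

theorem mem_lineOf {M : Matrix (Fin 2) (Fin 2) k} {v : Fin 4 → k} :
    v ∈ D.lineOf M ↔ (D.e v).1 = M *ᵥ (D.e v).2 := by
  constructor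
  · rintro ⟨τ, rfl⟩
    simp
  · intro h
    refine ⟨(D.e v).2, ?_⟩
    change D.e.symm (M *ᵥ (D.e v).2, (D.e v).2) = v
    rw [← h]
    exact D.e.symm_apply_apply v

theorem symm_mem_lineOf (M : Matrix (Fin 2) (Fin 2) k) (τ : Fin 2 → k) :
    D.e.symm (M *ᵥ τ, τ) ∈ D.lineOf M := ⟨τ, rfl⟩

theorem finrank_lineOf (M : Matrix (Fin 2) (Fin 2) k) : Module.finrank k (D.lineOf M) = 2 := by
  rw [lineOf, LinearMap.finrank_range_of_inj, Module.finrank_fin_fun]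
  intro τ τ' h
  exact congrArg Prod.snd (D.e.symm.injective h)

theorem lineOf_injective : Function.Injective D.lineOf := by
  intro M M' h
  refine Matrix.ext_of_mulVec_single fun i => ?_
  have h1 := D.symm_mem_lineOf M (Pi.single i 1)
  rw [h, mem_lineOf, LinearEquiv.apply_symm_apply] at h1
  exact h1

end

variable {p : ℕ} [Fact p.Prime] [CharP k p] {a : ℕ} {L : (Fin 4 → k) →ₗ[k] (Fin 2 → k)}
  (D : NormalForm (p ^ a) L)

theorem isLineOnSurface_lineOf (M : hermitian k p a) : IsLineOnSurface (p ^ a) (D.lineOf M.1) := by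
  refine ⟨D.finrank_lineOf _, (points_subset_surface_iff
    (pow_ne_zero _ (Fact.out : p.Prime).ne_zero)).2 fun v hv => ?_⟩
  rw [D.form_eq, D.mem_lineOf.1 hv, dot_mulVec_of_mem_hermitian p a M.2, sub_self]

theorem range_sectionOf (M : hermitian k p a) :
    (Set.range fun t => (D.sectionOf M t).pt) = points (D.lineOf M.1) := by
  ext P
  constructor
  · rintro ⟨t, rfl⟩
    change (D.sectionOf M t).pt ∈ _
    rw [D.pt_eq, mk_mem_points_iff, D.coord_sectionOf]
    exact D.symm_mem_lineOf _ _
  · intro hP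
    rw [← P.mk_rep, mk_mem_points_iff, mem_lineOf] at hP
    have hy : (D.e P.rep).2 ≠ 0 := by
      intro h
      refine P.rep_nonzero (D.e.map_eq_zero_iff.1 (Prod.ext ?_ h))
      rw [hP, h, Matrix.mulVec_zero]
      rfl
    obtain ⟨c, hc, h⟩ := D.exists_dir_mk_eq_smul ((LinearEquiv.map_ne_zero_iff D.m).2 hy)
    refine ⟨Projectivization.mk k _ ((LinearEquiv.map_ne_zero_iff D.m).2 hy), ?_⟩
    change (D.sectionOf M _).pt = P
    rw [D.pt_eq]
    conv_rhs => rw [← P.mk_rep]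
    refine mk_eq_mk_of_eq_smul (a := c) _ _ ?_
    rw [D.coord_sectionOf, h, Matrix.mulVec_smul, ← hP, ← Prod.smul_mk, map_smul]
    congr 1
    exact D.e.symm_apply_apply _

theorem lineOf_mem_transversalLines (M : hermitian k p a) :
    D.lineOf M.1 ∈ transversalLines (p ^ a) L := by
  have hpt : ∀ t, (D.sectionOf M t).1.1 ∈ points (D.lineOf M.1) := fun t => by
    rw [← D.range_sectionOf]
    exact ⟨t, rfl⟩
  have h10 : D.m ![1, 0] ≠ 0 :=
    (LinearEquiv.map_ne_zero_iff _).2 fun h => one_ne_zero (congrFun h 0)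
  have h01 : D.m ![0, 1] ≠ 0 :=
    (LinearEquiv.map_ne_zero_iff _).2 fun h => one_ne_zero (congrFun h 1)
  refine ⟨D.isLineOnSurface_lineOf M, fun h => ?_, fun t _ h => ?_⟩
  · have := hpt (Projectivization.mk k _ h10)
    rw [h] at this
    exact (D.sectionOf M (Projectivization.mk k _ h10)).1.2.2 this
  · have key : ∀ t', t' = t := fun t' =>
      (D.sectionOf M t').2.symm.trans (h (D.sectionOf M t').1 (hpt t'))
    obtain ⟨c, -, hc⟩ := exists_eq_smul_of_mk_eq_mk
      ((key (Projectivization.mk k _ h10)).trans (key (Projectivization.mk k _ h01)).symm)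
    rw [← map_smul] at hc
    simpa using congrFun (D.m.injective hc) 0

/-- A line on the surface that meets `ker L` lies in a plane `t` of the pencil; by isotropy `τ^q`
and `τ^{1/q}`, for `τ = dir t`, are orthogonal to a nonzero vector, which forces the fibre to be
singular. Hence a transversal line is the graph of a matrix, which is Hermitian because the line is
isotropic. -/
theorem exists_eq_lineOf [IsAlgClosed k] (ha : 0 < a) (hL : Module.finrank k (LinearMap.ker L) = 2)
    {W : Submodule k (Fin 4 → k)} (hW : W ∈ transversalLines (p ^ a) L) :
    ∃ M : hermitian k p a, W = D.lineOf M.1 := by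
  have hq : 1 < p ^ a := Nat.one_lt_pow ha.ne' (Fact.out : p.Prime).one_lt
  have hq0 : p ^ a ≠ 0 := by omega
  obtain ⟨⟨hW2, hWS⟩, hWne, hWt⟩ := hW
  rw [points_subset_surface_iff hq0] at hWS
  let f : W →ₗ[k] (Fin 2 → k) := LinearMap.snd k _ _ ∘ₗ D.e.toLinearMap ∘ₗ W.subtype
  have hf : ∀ v : W, f v = (D.e v.1).2 := fun _ => rfl
  by_cases hinj : Function.Injective f
  · let E := LinearMap.linearEquivOfInjective f hinj (by rw [hW2, Module.finrank_fin_fun])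
    have hE : ∀ v, E v = f v := fun v => LinearMap.linearEquivOfInjective_apply ..
    let A : (Fin 2 → k) →ₗ[k] (Fin 2 → k) :=
      LinearMap.fst k _ _ ∘ₗ D.e.toLinearMap ∘ₗ W.subtype ∘ₗ E.symm.toLinearMap
    have hWA : W = D.lineOf (LinearMap.toMatrix' A) := by
      refine Submodule.eq_of_le_of_finrank_eq (fun v hv => ?_) (by rw [hW2, D.finrank_lineOf])
      rw [mem_lineOf, LinearMap.toMatrix'_mulVec, ← hf ⟨v, hv⟩, ← hE]
      simp [A]
    refine ⟨⟨LinearMap.toMatrix' A, mem_hermitian_of_dot_mulVec p a hq fun τ _ => ?_⟩, hWA⟩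
    have h := hWS _ (hWA ▸ D.symm_mem_lineOf (LinearMap.toMatrix' A) τ)
    rw [D.form_eq, LinearEquiv.apply_symm_apply] at h
    exact sub_eq_zero.1 h
  · exfalso
    have hker : LinearMap.ker f ≠ ⊥ := fun h => hinj (LinearMap.ker_eq_bot.1 h)
    obtain ⟨w, hw, hw0⟩ := Submodule.exists_mem_ne_zero_of_ne_bot hker
    have hrange : Module.finrank k (LinearMap.range f) ≤ 1 := by
      have h1 := LinearMap.finrank_range_add_finrank_ker f
      have h2 : 0 < Module.finrank k (LinearMap.ker f) :=
        Nat.pos_of_ne_zero fun h => hker (Submodule.finrank_eq_zero.1 h)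
      omega
    obtain ⟨⟨_, v, rfl⟩, hv⟩ := finrank_le_one_iff.1 hrange
    replace hv : ∀ u : W, ∃ c : k, f u = c • f v := fun u => by
      obtain ⟨c, hc⟩ := hv ⟨f u, u, rfl⟩
      exact ⟨c, (congrArg Subtype.val hc).symm⟩
    have hv0 : f v ≠ 0 := by
      intro h0
      refine hWne (Submodule.eq_of_le_of_finrank_eq (fun u hu => ?_) (by rw [hW2, hL]))
      obtain ⟨c, hc⟩ := hv ⟨u, hu⟩
      rw [h0, smul_zero, hf] at hc
      rw [LinearMap.mem_ker, D.L_eq, hc, map_zero]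
    have hmv : D.m (f v) ≠ 0 := (LinearEquiv.map_ne_zero_iff _).2 hv0
    refine hWt (Projectivization.mk k _ hmv) ?_ fun P hP => ?_
    · rw [D.isSingularFibre_iff ha]
      obtain ⟨c, hc, hdir⟩ := D.exists_dir_mk_eq_smul hmv
      rw [hdir, isDegenerate_smul_iff _ hc]
      have hw2 : (D.e w.1).2 = 0 := hw
      have hx : (D.e w.1).1 ≠ 0 := fun h =>
        hw0 (Subtype.ext (D.e.map_eq_zero_iff.1 (Prod.ext h hw2)))
      set x := (D.e w.1).1 with hxdef
      set y := f v with hy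
      obtain ⟨h1, h2⟩ := eq_zero_of_add_pow_eq_zero hq (A := dot (p ^ a) x y)
        (B := -dot (p ^ a) y x) fun s => by
          have h3 := hWS _ (W.add_mem (W.smul_mem s w.2) v.2)
          have h4 := hWS _ v.2
          rw [D.form_eq, ← hf, ← hy] at h4
          rw [D.form_eq, map_add, map_smul, Prod.snd_add, Prod.fst_add, Prod.smul_fst,
            Prod.smul_snd, hw2, smul_zero, zero_add, ← hf, ← hy, ← hxdef, dot_add_left,
            dot_add_right, dot_smul_left, dot_smul_right] at h3
          linear_combination h3 - h4
      rw [neg_eq_zero] at h2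
      have h3 : x 0 ^ p ^ a * y 0 ^ (p ^ a) ^ 2 + x 1 ^ p ^ a * y 1 ^ (p ^ a) ^ 2 = 0 := by
        have := congrArg (· ^ p ^ a) h1
        simp only [dot, add_pow_expChar_pow, mul_pow, zero_pow hq0] at this
        rw [sq, pow_mul, pow_mul]
        exact this
      rw [dot] at h2
      have h4 : x 0 ^ p ^ a * (y 0 ^ (p ^ a) ^ 2 * y 1 - y 1 ^ (p ^ a) ^ 2 * y 0) = 0 := by
        linear_combination y 1 * h3 - y 1 ^ (p ^ a) ^ 2 * h2
      have h5 : x 1 ^ p ^ a * (y 0 ^ (p ^ a) ^ 2 * y 1 - y 1 ^ (p ^ a) ^ 2 * y 0) = 0 := by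
        linear_combination y 0 ^ (p ^ a) ^ 2 * h2 - y 0 * h3
      by_contra hdeg
      have hne := sub_ne_zero.2 hdeg
      refine hx (funext fun i => ?_)
      fin_cases i
      · exact (pow_eq_zero_iff hq0).1 ((mul_eq_zero.1 h4).resolve_right hne)
      · exact (pow_eq_zero_iff hq0).1 ((mul_eq_zero.1 h5).resolve_right hne)
    · have hPW : P.1.rep ∈ W := by
        rw [← P.1.mk_rep, mk_mem_points_iff] at hP
        exact hP
      obtain ⟨c, hc⟩ := hv ⟨_, hPW⟩
      refine mk_eq_mk_of_eq_smul (a := c) _ _ ?_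
      rw [D.L_eq, ← map_smul, ← hc, hf]

theorem transversalLines_eq_range [IsAlgClosed k] (ha : 0 < a)
    (hL : Module.finrank k (LinearMap.ker L) = 2) :
    transversalLines (p ^ a) L = Set.range fun M : hermitian k p a => D.lineOf M.1 := by
  ext W
  constructor
  · intro hW
    obtain ⟨M, rfl⟩ := D.exists_eq_lineOf ha hL hW
    exact ⟨M, rfl⟩
  · rintro ⟨M, rfl⟩
    exact D.lineOf_mem_transversalLines M

end NormalForm

end Lines

end LinePencil

theorem theorem4p4 {k : Type*} [Field k] [IsAlgClosed k] (p : ℕ) [Fact p.Prime] [CharP k p]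
    (a : ℕ) (ha : 0 < a)
    (ℓ : Submodule k (Fin 4 → k)) (hℓ : LinePencil.IsLineOnSurface (p ^ a) ℓ)
    (L : (Fin 4 → k) →ₗ[k] (Fin 2 → k)) (hL : LinearMap.ker L = ℓ) :
    -- there is a group scheme structure on `S ∖ ℓ → ℙ¹`
    Nonempty (LinePencil.PencilGroup (p ^ a) L) ∧
    -- the pencil has exactly `q² + 1` singular fibres
    {t | LinePencil.IsSingularFibre (p ^ a) L t}.ncard = (p ^ a) ^ 2 + 1 ∧
    -- for each group scheme structure, the other fibres are additive groups and the group of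
    -- sections is an elementary abelian group of rank `4a`
    (∀ [LinePencil.PencilGroup (p ^ a) L],
      (∀ t, ¬ LinePencil.IsSingularFibre (p ^ a) L t →
        LinePencil.IsAdditiveFibre (p ^ a) L t) ∧
      Nonempty (LinePencil.sections (p ^ a) L ≃* Multiplicative (Fin (4 * a) → ZMod p))) ∧
    -- the sections are the lines on `S` that are neither in a singular fibre nor equal to `ℓ`
    Set.BijOn (fun σ : ∀ t, LinePencil.Fibre (p ^ a) L t => Set.range fun t => (σ t).pt)
      {σ | LinePencil.IsSection (p ^ a) L σ}
      (LinePencil.points '' LinePencil.transversalLines (p ^ a) L) ∧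
    -- and there are `q⁴` such lines
    (LinePencil.transversalLines (p ^ a) L).ncard = (p ^ a) ^ 4 := by
  subst hL
  obtain ⟨D⟩ := LinePencil.exists_normalForm p a ha L hℓ
  have hlines := D.transversalLines_eq_range ha hℓ.1
  refine ⟨⟨D.pencilGroup⟩, D.ncard_isSingularFibre ha, ⟨fun t ht => ?_, ?_⟩, ⟨?_, ?_, ?_⟩, ?_⟩
  · rw [D.isSingularFibre_iff ha] at ht
    exact D.isAdditiveFibre_of_not_isDegenerate ht
  · obtain ⟨e⟩ := D.nonempty_sections_mulEquiv ha
    obtain ⟨e'⟩ := LinePencil.nonempty_hermitian_addEquiv k p a ha.ne'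
    exact ⟨e.trans e'.toMultiplicative⟩
  · intro σ hσ
    obtain ⟨M, rfl⟩ := D.exists_eq_sectionOf ha hσ
    exact ⟨D.lineOf M.1, D.lineOf_mem_transversalLines M, (D.range_sectionOf M).symm⟩
  · exact LinePencil.injective_range_section.injOn
  · rintro _ ⟨W, hW, rfl⟩
    obtain ⟨M, rfl⟩ := D.exists_eq_lineOf ha hℓ.1 hW
    exact ⟨D.sectionOf M, D.isSection_sectionOf M, D.range_sectionOf M⟩
  · have hinj : Function.Injective fun M : LinePencil.hermitian k p a => D.lineOf M.1 :=
      D.lineOf_injective.comp Subtype.val_injective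
    rw [hlines, ← Set.image_univ, Set.ncard_image_of_injective _ hinj, Set.ncard_univ,
      LinePencil.card_hermitian p a ha.ne', ← pow_mul, mul_comm]
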